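/- Let $K$ be a field of characteristic zero (for instance a subfield of $\mathbb C$), $\overline K$ an algebraic closure of $K$, and $L$ a field with $K\subseteq L\subseteq\overline K$. Let $b\ge 2$ and $r\ge0$ be integers and let $\ell_0,\dots,\ell_r\in K[x]$ with $\ell_0\ne0$ and $\ell_r\neq 0$. Consider the linear Mahler equation $$\ell_r M^r y+\dots+\ell_1 My+\ell_0 y=0,\qquad\text{(L)}$$ where $M$ is the Mahler operator $y(x)\mapsto y(x^b)$. *Generalized series.* For a field $F$, let $\mathrm{Pui}(F)=\bigcup_{q\ge1}F((x^{1/q}))$ be the field of Puiseux series and $\mathrm{Ram}(F)=\bigcup_{q\ge1}F(x^{1/q})\subseteq\mathrm{Pui}(F)$ the field of ramified rational functions. Let $D_F=\bigoplus_{\lambda\in F\setminus\{0\}}e(\lambda)\,\mathrm{Pui}(F)$ be the ring with $e(\lambda)e(\mu)=e(\lambda\mu)$ and $e(1)=1$. The operator $M$ acts on $D_F$ as the ring endomorphism with $Me(\lambda)=\lambda e(\lambda)$ and $(Mp)(x)=p(x^b)$ for $p\in\mathrm{Pui}(F)$. An element $y\in D_L$ is *hypergeometric* if $My=uy$ for some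 $u\in\mathrm{Ram}(L)$. Elements $y_1,y_2\in D_L$ are *similar* if $y_1=uy_2$ for some nonzero $u\in\mathrm{Ram}(L)$. This is an equivalence relation; the nontrivial similarity classes of hypergeometric solutions of (L) in $D_L$ are its classes other than $\{0\}$ on the set of those solutions. *Newton polygon.* The lower Newton polygon of (L) is the lower convex hull of the points $(b^k,m)$ for which the coefficient $\ell_{k,m}$ of $x^m$ in $\ell_k$ is nonzero. The characteristic polynomial of an edge whose left end has abscissa $b^{k_1}$ is $\chi(X)=\sum\ell_{k,m}X^{k-k_1}$, summed over the points $(b^k,m)$ above that lie on the edge. For $\lambda\in\overline K$, an edge is *$\lambda$-admissible* if its characteristic polynomial vanishes at $\lambda$. Let $q_\lambda$ be the least common multiple of those denominators, in lowest terms, of the slopes of the $\lambda$-admissible edges that are coprime to $b$ (with $q_\lambda=1$ if there are none). Let $\Lambda'$ be the set of all $\lambda\in\overline K$ for which there is a $\lambda$-admissible edge and (L) has a nonzero solution in $e(\lambda)\,\mathrm{Pui}(\overline K)$. **Proposition.** Let $\mathcal C\subseteq D_L$ be a nontrivial similarity class of hypergeometric solutions of (L), and let $\mathfrak H=\mathcal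 C\cup\{0\}$. Then there is exactly one tuple $(\lambda,g,(p_j)_{1\le j\le s})$ consisting of an element $\lambda\in L\cap\Lambda'$, a rational function $g\in L(x)$ with $g(0)=1$, an integer $s>0$ and Laurent polynomials $p_1,\dots,p_s\in L[x,x^{-1}]$, such that: 1. the $s$ generalized series $$e(\lambda)\;p_j(x^{1/q_\lambda})\;\prod_{k\ge0}\frac1{g(x^{b^k/q_\lambda})},\qquad 1\le j\le s,$$ form a basis of $\mathfrak H$, which is an $L$-linear subspace of $D_L$; 2. the family $(p_1,\dots,p_s)$ is in reduced echelon form with respect to ascending degree: the valuations $v_j$ of the $p_j$ satisfy $v_1<\dots<v_s$, the coefficient of $x^{v_j}$ in $p_j$ is $1$, and the coefficient of $x^{v_j}$ in $p_i$ is $0$ for $i\ne j$; 3. $p_1,\dots,p_s$ are coprime in $L[x,x^{-1}]$, that is, their only common divisors are units. -/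

import Mathlib

open Polynomial

noncomputable section

namespace Mahler

/-! ### Puiseux series and ramified rational functions -/

section Puiseux

variable (L : Type*) [Field L]

/-- The substitution `x ↦ x ^ (1 / q)`, from Laurent series in `x` to Hahn series with rational
exponents. -/
def hahnRamify (q : ℕ+) : LaurentSeries L →+* HahnSeries ℚ L :=
  HahnSeries.embDomainRingHom
    { toFun := fun n : ℤ => (n : ℚ) / (q : ℕ)
      map_zero' := by simp
      map_add' := fun m n => by push_cast; ring }
    (fun m n h => by
      have hq : ((q : ℕ) : ℚ) ≠ 0 := by exact_mod_cast q.ne_zero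
      have h' : (m : ℚ) / (q : ℕ) = (n : ℚ) / (q : ℕ) := h
      field_simp at h'
      exact_mod_cast h')
    (fun m n => by
      have hq : (0 : ℚ) < (q : ℕ) := by exact_mod_cast q.pos
      change (m : ℚ) / (q : ℕ) ≤ (n : ℚ) / (q : ℕ) ↔ m ≤ n
      rw [div_le_div_iff_of_pos_right hq]
      exact Int.cast_le)

/-- The substitution `x ↦ x ^ n` on Laurent series. -/
def laurentExpand (n : ℕ+) : LaurentSeries L →+* LaurentSeries L :=
  HahnSeries.embDomainRingHom
    { toFun := fun k : ℤ => ((n : ℕ) : ℤ) * k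
      map_zero' := by simp
      map_add' := fun m n => by ring }
    (fun k l h => by
      have hn : ((n : ℕ) : ℤ) ≠ 0 := by exact_mod_cast n.ne_zero
      exact mul_left_cancel₀ hn h)
    (fun k l => by
      have hn : (0 : ℤ) < (n : ℕ) := by exact_mod_cast n.pos
      exact mul_le_mul_iff_right₀ hn)

/-- The substitution `x ↦ x ^ b` on Hahn series with rational exponents. -/
def hahnExpand (b : ℕ+) : HahnSeries ℚ L →+* HahnSeries ℚ L :=
  HahnSeries.embDomainRingHom
    { toFun := fun k : ℚ => ((b : ℕ) : ℚ) * k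
      map_zero' := by simp
      map_add' := fun m n => by ring }
    (fun k l h => by
      have hn : ((b : ℕ) : ℚ) ≠ 0 := by exact_mod_cast b.ne_zero
      exact mul_left_cancel₀ hn h)
    (fun k l => by
      have hn : (0 : ℚ) < (b : ℕ) := by exact_mod_cast b.pos
      exact mul_le_mul_iff_right₀ hn)

variable {L}

theorem embDomain_comp_aux {Γ₁ Γ₂ Γ₃ : Type*} [PartialOrder Γ₁] [PartialOrder Γ₂]
    [PartialOrder Γ₃] (f : Γ₁ ↪o Γ₂) (g : Γ₂ ↪o Γ₃) (h : Γ₁ ↪o Γ₃) (hfg : ∀ a, g (f a) = h a)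
    (x : HahnSeries Γ₁ L) :
    HahnSeries.embDomain g (HahnSeries.embDomain f x) = HahnSeries.embDomain h x := by
  ext c
  by_cases hc : c ∈ Set.range h
  · obtain ⟨a, rfl⟩ := hc
    rw [HahnSeries.embDomain_coeff, ← hfg, HahnSeries.embDomain_coeff, HahnSeries.embDomain_coeff]
  · rw [HahnSeries.embDomain_of_notMem_range hc]
    by_cases hc' : c ∈ Set.range g
    · obtain ⟨d, rfl⟩ := hc'
      rw [HahnSeries.embDomain_coeff]
      apply HahnSeries.embDomain_of_notMem_range
      rintro ⟨a, rfl⟩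
      exact hc ⟨a, (hfg a).symm⟩
    · exact HahnSeries.embDomain_of_notMem_range hc'

theorem hahnRamify_mul_expand (q n : ℕ+) (f : LaurentSeries L) :
    hahnRamify L (q * n) (laurentExpand L n f) = hahnRamify L q f := by
  refine embDomain_comp_aux (L := L) (Γ₁ := ℤ) (Γ₂ := ℤ) (Γ₃ := ℚ) ⟨⟨_, _⟩, _⟩ ⟨⟨_, _⟩, _⟩ ⟨⟨_, _⟩, _⟩
    (fun a => ?_) f
  change (((((n : ℕ) : ℤ) * a : ℤ)) : ℚ) / ((q * n : ℕ+) : ℕ) = (a : ℚ) / (q : ℕ)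
  have hn : ((n : ℕ) : ℚ) ≠ 0 := by exact_mod_cast n.ne_zero
  have hq : ((q : ℕ) : ℚ) ≠ 0 := by exact_mod_cast q.ne_zero
  push_cast
  field_simp

theorem hahnExpand_hahnRamify (b q : ℕ+) (f : LaurentSeries L) :
    hahnExpand L b (hahnRamify L q f) = hahnRamify L q (laurentExpand L b f) := by
  have h1 : ((b : ℕ) : ℚ) ≠ 0 := by exact_mod_cast b.ne_zero
  have h2 : hahnRamify L q f = hahnRamify L (q * b) (laurentExpand L b f) :=
    (hahnRamify_mul_expand q b f).symm
  rw [h2]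
  refine embDomain_comp_aux (L := L) (Γ₁ := ℤ) (Γ₂ := ℚ) (Γ₃ := ℚ) ⟨⟨_, _⟩, _⟩ ⟨⟨_, _⟩, _⟩ ⟨⟨_, _⟩, _⟩
    (fun a => ?_) _
  change ((b : ℕ) : ℚ) * ((a : ℚ) / ((q * b : ℕ+) : ℕ)) = (a : ℚ) / (q : ℕ)
  have hq : ((q : ℕ) : ℚ) ≠ 0 := by exact_mod_cast q.ne_zero
  push_cast
  field_simp

theorem exists_common_ramification {f g : HahnSeries ℚ L}
    (hf : ∃ q : ℕ+, f ∈ Set.range (hahnRamify L q))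
    (hg : ∃ q : ℕ+, g ∈ Set.range (hahnRamify L q)) :
    ∃ (q : ℕ+) (f' g' : LaurentSeries L), hahnRamify L q f' = f ∧ hahnRamify L q g' = g := by
  obtain ⟨q, f', rfl⟩ := hf
  obtain ⟨n, g', rfl⟩ := hg
  refine ⟨q * n, laurentExpand L n f', laurentExpand L q g', hahnRamify_mul_expand q n f', ?_⟩
  rw [mul_comm]
  exact hahnRamify_mul_expand n q g'

variable (L)

/-- The field of Puiseux series over `L`: the union over `q ≥ 1` of the fields `L((x^{1/q}))`. -/
def Puiseux : Subfield (HahnSeries ℚ L) where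
  carrier := {f | ∃ q : ℕ+, f ∈ Set.range (hahnRamify L q)}
  mul_mem' := by
    intro f g hf hg
    obtain ⟨q, f', g', rfl, rfl⟩ := exists_common_ramification hf hg
    exact ⟨q, f' * g', map_mul _ _ _⟩
  add_mem' := by
    intro f g hf hg
    obtain ⟨q, f', g', rfl, rfl⟩ := exists_common_ramification hf hg
    exact ⟨q, f' + g', map_add _ _ _⟩
  zero_mem' := ⟨1, 0, map_zero _⟩
  one_mem' := ⟨1, 1, map_one _⟩
  neg_mem' := by
    rintro _ ⟨q, f, rfl⟩
    exact ⟨q, -f, map_neg _ _⟩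
  inv_mem' := by
    rintro _ ⟨q, f, rfl⟩
    exact ⟨q, f⁻¹, map_inv₀ _ _⟩

variable {L}

/-- `f(x) ↦ f(x^{1/q})`, from Laurent series to Puiseux series. -/
def ramify (q : ℕ+) : LaurentSeries L →+* Puiseux L :=
  (hahnRamify L q).codRestrict (Puiseux L) (fun f => ⟨q, f, rfl⟩)

/-- Elements of `L` are constant Puiseux series. -/
instance : Algebra L (Puiseux L) := ((ramify 1).comp HahnSeries.C).toAlgebra

/-- The Mahler operator `f(x) ↦ f(x^b)` on Puiseux series. -/
def mahlerPuiseux (b : ℕ+) : Puiseux L →+* Puiseux L :=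
  ((hahnExpand L b).comp (Puiseux L).subtype).codRestrict (Puiseux L) (by
    rintro ⟨_, q, f, rfl⟩
    exact ⟨q, laurentExpand L b f, (hahnExpand_hahnRamify b q f).symm⟩)

/-- A Laurent polynomial, viewed as a Laurent series. -/
def laurentPolyToSeries (p : LaurentPolynomial L) : LaurentSeries L :=
  ∑ n ∈ p.coeff.support, HahnSeries.single n (p.coeff n)

/-- For a polynomial `A`, the Puiseux series `A(x^{1/q})`. -/
def polyRamify (q : ℕ+) (A : L[X]) : Puiseux L :=
  ramify q (HahnSeries.ofPowerSeries ℤ L (A : PowerSeries L))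

variable (L)

/-- The ramified rational functions: the union over `q ≥ 1` of the fields `L(x^{1/q})`, as a
subset of the field of Puiseux series. -/
def RamRat : Set (Puiseux L) :=
  {u | ∃ (q : ℕ+) (A B : L[X]), B ≠ 0 ∧ u = polyRamify q A / polyRamify q B}

end Puiseux

/-! ### The difference ring of generalized series -/

section DifferenceRing

/-- The ring `⨁_{λ ∈ L \ {0}} e(λ) · Puiseux(L)`, with `e(λ) e(μ) = e(λ μ)` and `e(1) = 1`; the
element `e(λ) p` is `MonoidAlgebra.single λ p`. -/
abbrev GenSeries (L : Type*) [Field L] : Type _ := MonoidAlgebra (Puiseux L) Lˣ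

variable {L : Type*} [Field L]

/-- The generalized series `e(λ) · p`. -/
def expo (lam : Lˣ) (p : Puiseux L) : GenSeries L := MonoidAlgebra.single lam p

/-- The Mahler operator on generalized series: the ring endomorphism which is `p(x) ↦ p(x^b)` on
Puiseux series and maps `e(λ)` to `λ e(λ)`. -/
def mahler (b : ℕ+) : GenSeries L →+* GenSeries L :=
  MonoidAlgebra.liftNCRingHom
    ((MonoidAlgebra.singleOneRingHom : Puiseux L →+* GenSeries L).comp
      (mahlerPuiseux b))
    { toFun := fun lam : Lˣ => expo lam (algebraMap L (Puiseux L) (lam : L))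
      map_one' := by simp [expo, MonoidAlgebra.one_def]
      map_mul' := fun lam mu => by simp [expo, MonoidAlgebra.single_mul_single] }
    (fun _ _ => Commute.all _ _)

theorem mahler_expo (b : ℕ+) (lam : Lˣ) (p : Puiseux L) :
    mahler b (expo lam p) = expo lam ((lam : L) • mahlerPuiseux b p) := by
  simp [mahler, expo, MonoidAlgebra.single_mul_single, Algebra.smul_def, mul_comm]

/-- `y` is hypergeometric over the field of ramified rational functions: `M y = u y` for some
ramified rational function `u`. -/
def IsRamRatHypergeometric (b : ℕ+) (y : GenSeries L) : Prop :=
  ∃ u ∈ RamRat L, mahler b y = u • y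

/-- `y₁` and `y₂` are similar over the field of ramified rational functions. -/
def RamRatSimilar (y₁ y₂ : GenSeries L) : Prop :=
  ∃ u ∈ RamRat L, u ≠ 0 ∧ y₁ = u • y₂

variable {K : Type*} [Field K] [Algebra K L]

/-- The value `ℓ_r M^r y + ⋯ + ℓ_1 M y + ℓ_0 y` of a linear Mahler operator at `y`. -/
def applyOp (b : ℕ+) {r : ℕ} (ℓ : Fin (r + 1) → K[X]) (y : GenSeries L) : GenSeries L :=
  ∑ k : Fin (r + 1), polyRamify 1 ((ℓ k).map (algebraMap K L)) • (mahler b)^[(k : ℕ)] y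

/-- `C` is a nontrivial class, for similarity over the ramified rational functions, of the
hypergeometric solutions of the equation: the class of some nonzero hypergeometric solution `y₀`. -/
def IsNontrivialSimilarityClass (b : ℕ+) {r : ℕ} (ℓ : Fin (r + 1) → K[X])
    (C : Set (GenSeries L)) : Prop :=
  ∃ y₀ : GenSeries L, y₀ ≠ 0 ∧ applyOp b ℓ y₀ = 0 ∧ IsRamRatHypergeometric b y₀ ∧
    C = {y | applyOp b ℓ y = 0 ∧ IsRamRatHypergeometric b y ∧ RamRatSimilar y y₀}

end DifferenceRing

/-! ### The lower Newton polygon, its characteristic polynomials, the ramification bounds -/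

section Newton

variable {K : Type*} [Field K] (b : ℕ+) {r : ℕ} (ℓ : Fin (r + 1) → K[X])

/-- The slope of the line through the lowest points at abscissae `b^i` and `b^j`. The lowest point
at abscissa `b^k` exists if `ℓ_k ≠ 0`, and its ordinate is the valuation of `ℓ_k`. -/
def edgeSlope (i j : Fin (r + 1)) : ℚ :=
  (((ℓ j).natTrailingDegree : ℚ) - ((ℓ i).natTrailingDegree : ℚ)) /
    (((b : ℕ) : ℚ) ^ (j : ℕ) - ((b : ℕ) : ℚ) ^ (i : ℕ))

/-- The ordinate at abscissa `b^k` of the line through the lowest points at `b^i` and `b^j`. -/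
def edgeHeight (i j k : Fin (r + 1)) : ℚ :=
  ((ℓ i).natTrailingDegree : ℚ) +
    edgeSlope b ℓ i j * (((b : ℕ) : ℚ) ^ (k : ℕ) - ((b : ℕ) : ℚ) ^ (i : ℕ))

/-- The lowest points at abscissae `b^i < b^j` are the end points of an edge of the lower Newton
polygon: all points lie on or above the line through them, and no point of that line lies outside
of the segment. -/
def IsLowerEdge (i j : Fin (r + 1)) : Prop :=
  i < j ∧ ℓ i ≠ 0 ∧ ℓ j ≠ 0 ∧ ∀ k : Fin (r + 1), ℓ k ≠ 0 →
    edgeHeight b ℓ i j k ≤ ((ℓ k).natTrailingDegree : ℚ) ∧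
    (((ℓ k).natTrailingDegree : ℚ) = edgeHeight b ℓ i j k → i ≤ k ∧ k ≤ j)

open scoped Classical in
/-- The characteristic polynomial of the edge between abscissae `b^i` and `b^j`: the sum of
`c X^(k - i)` over the terms `c x^m M^k` of the operator whose point `(b^k, m)` is on the edge. -/
def edgeCharPoly (i j : Fin (r + 1)) : K[X] :=
  ∑ k ∈ Finset.Icc i j,
    if ((ℓ k).natTrailingDegree : ℚ) = edgeHeight b ℓ i j k then
      Polynomial.monomial ((k : ℕ) - (i : ℕ)) (ℓ k).trailingCoeff
    else 0

variable {Kbar : Type*} [Field Kbar] [Algebra K Kbar]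

/-- The edge between `b^i` and `b^j` is `λ`-admissible. -/
def IsAdmissibleEdge (lam : Kbar) (i j : Fin (r + 1)) : Prop :=
  IsLowerEdge b ℓ i j ∧ aeval lam (edgeCharPoly b ℓ i j) = 0

variable (Kbar) in
/-- The set `Λ` of all roots of all characteristic polynomials. -/
def rootSet : Set Kbar := {lam | ∃ i j : Fin (r + 1), IsAdmissibleEdge b ℓ lam i j}

variable (Kbar) in
/-- The set `Λ'` of all `λ` in `Λ` such that the equation has a nonzero solution of the form
`e(λ) p` with a Puiseux series `p` over `Kbar`. -/
def solRootSet : Set Kbar :=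
  {lam | lam ∈ rootSet b ℓ Kbar ∧
    ∃ (mu : Kbarˣ) (p : Puiseux Kbar), (mu : Kbar) = lam ∧ p ≠ 0 ∧ applyOp b ℓ (expo mu p) = 0}

open scoped Classical in
/-- The ramification bound `q_λ`: the least common multiple of those denominators of slopes of
`λ`-admissible edges that are coprime to `b`. -/
def ramBound (lam : Kbar) : ℕ+ :=
  ⟨(Finset.univ.filter fun e : Fin (r + 1) × Fin (r + 1) =>
      IsAdmissibleEdge b ℓ lam e.1 e.2 ∧ Nat.Coprime b (edgeSlope b ℓ e.1 e.2).den).lcm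
        fun e => (edgeSlope b ℓ e.1 e.2).den,
    Nat.pos_of_ne_zero fun h => by
      obtain ⟨e, -, he⟩ := Finset.lcm_eq_zero_iff.mp h
      exact (edgeSlope b ℓ e.1 e.2).den_nz he⟩

end Newton

/-! ### Normal forms -/

section NormalForm

variable {L : Type*} [Field L]

/-- The power series `1 / g(x^(b^k))`, for a rational function `g` with `g(0) = 1`. -/
def invFactor (b : ℕ+) (g : RatFunc L) (k : ℕ) : PowerSeries L :=
  ((expand L ((b : ℕ) ^ k) g.denom : L[X]) : PowerSeries L) *
    ((expand L ((b : ℕ) ^ k) g.num : L[X]) : PowerSeries L)⁻¹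

/-- The infinite product `∏_{k ≥ 0} 1 / g(x^(b^k))`, for a rational function `g` with `g(0) = 1`
and for `b ≥ 2`. Its `n`th coefficient is that of every product of at least `n + 1` factors, see
`coeff_prod_invFactor`. -/
def infProd (b : ℕ+) (g : RatFunc L) : PowerSeries L :=
  PowerSeries.mk fun n =>
    PowerSeries.coeff n (∏ k ∈ Finset.range (n + 1), invFactor b g k)

theorem coeff_prod_of_eq_one_mod {A : ℕ → PowerSeries L} {n : ℕ}
    (hA : ∀ k, n < k → ∀ i ≤ n, PowerSeries.coeff i (A k) = PowerSeries.coeff i 1) (m : ℕ)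
    (hm : n + 1 ≤ m) :
    PowerSeries.coeff n (∏ k ∈ Finset.range m, A k) =
      PowerSeries.coeff n (∏ k ∈ Finset.range (n + 1), A k) := by
  induction m, hm using Nat.le_induction with
  | base => rfl
  | succ m hm ih =>
    rw [Finset.prod_range_succ, ← ih]
    conv_rhs => rw [← mul_one (∏ k ∈ Finset.range m, A k)]
    rw [PowerSeries.coeff_mul, PowerSeries.coeff_mul]
    refine Finset.sum_congr rfl fun x hx => ?_
    rw [hA m (by omega) x.2 (by have := Finset.HasAntidiagonal.mem_antidiagonal.mp hx; omega)]

theorem coeff_prod_invFactor (b : ℕ+) (hb : 2 ≤ (b : ℕ)) (g : RatFunc L)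
    (hg : RatFunc.eval (RingHom.id L) 0 g = 1) (n m : ℕ) (hm : n + 1 ≤ m) :
    PowerSeries.coeff n (∏ k ∈ Finset.range m, invFactor b g k) =
      PowerSeries.coeff n (infProd b g) := by
  rw [infProd, PowerSeries.coeff_mk]
  refine coeff_prod_of_eq_one_mod (fun k hk i hi => ?_) m hm
  have hbk : i < (b : ℕ) ^ k := by
    have h1 : k < (b : ℕ) ^ k := Nat.lt_pow_self (by omega)
    omega
  simp only [RatFunc.eval, Polynomial.eval₂_id] at hg
  have hd : g.denom.eval 0 ≠ 0 := by
    intro h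
    simp [h] at hg
  have hnd : g.num.eval 0 = g.denom.eval 0 := by
    field_simp at hg
    exact hg
  rw [← Polynomial.coeff_zero_eq_eval_zero, ← Polynomial.coeff_zero_eq_eval_zero] at hnd
  rw [← Polynomial.coeff_zero_eq_eval_zero] at hd
  have hpos : 0 < (b : ℕ) ^ k := pow_pos b.pos k
  set N : PowerSeries L := ((expand L ((b : ℕ) ^ k) g.num : L[X]) : PowerSeries L) with hN
  set D : PowerSeries L := ((expand L ((b : ℕ) ^ k) g.denom : L[X]) : PowerSeries L) with hD
  have hN0 : PowerSeries.constantCoeff N ≠ 0 := by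
    rw [← PowerSeries.coeff_zero_eq_constantCoeff_apply, hN, Polynomial.coeff_coe,
      Polynomial.coeff_expand hpos]
    simpa [hnd] using hd
  have hdvd : (PowerSeries.X : PowerSeries L) ^ ((b : ℕ) ^ k) ∣ D - N := by
    rw [PowerSeries.X_pow_dvd_iff]
    intro l hl
    rw [map_sub, hN, hD, Polynomial.coeff_coe, Polynomial.coeff_coe,
      Polynomial.coeff_expand hpos, Polynomial.coeff_expand hpos]
    by_cases h0 : l = 0
    · simp [h0, hnd]
    · rw [if_neg (Nat.not_dvd_of_pos_of_lt (Nat.pos_of_ne_zero h0) hl),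
        if_neg (Nat.not_dvd_of_pos_of_lt (Nat.pos_of_ne_zero h0) hl), sub_zero]
  have hsub : invFactor b g k - 1 = (D - N) * N⁻¹ := by
    rw [invFactor, sub_mul, PowerSeries.mul_inv_cancel N hN0]
  have := (PowerSeries.X_pow_dvd_iff.mp (hsub ▸ hdvd.mul_right N⁻¹)) i hbk
  rw [map_sub, sub_eq_zero] at this
  exact this

/-- The data `(λ, g, (p_1, …, p_s))`. -/
structure NormalFormData (L : Type*) [Field L] where
  lam : Lˣ
  g : RatFunc L
  s : ℕ
  p : Fin s → LaurentPolynomial L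

/-- The generalized series `e(λ) p_j(x^{1/q}) ∏_{k ≥ 0} 1 / g(x^{b^k/q})`. -/
def NormalFormData.basisElt (t : NormalFormData L) (b q : ℕ+) (j : Fin t.s) : GenSeries L :=
  expo t.lam (ramify q (laurentPolyToSeries (t.p j) *
    HahnSeries.ofPowerSeries ℤ L (infProd b t.g)))

/-- The family `p` is in reduced echelon form with respect to ascending degree: `v j` is the
valuation of `p j`, the valuations increase strictly, the coefficient of `p j` at `v j` is `1`, and
the coefficients of the other members at `v j` vanish. -/
def IsReducedEchelon {s : ℕ} (p : Fin s → LaurentPolynomial L) : Prop :=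
  ∃ v : Fin s → ℤ, StrictMono v ∧ (∀ j, ∀ n < v j, (p j).coeff n = 0) ∧
    ∀ i j, (p i).coeff (v j) = if i = j then 1 else 0

/-- The common divisors of the members of the family are units of the ring of Laurent
polynomials. -/
def IsCoprimeFamily {s : ℕ} (p : Fin s → LaurentPolynomial L) : Prop :=
  ∀ d : LaurentPolynomial L, (∀ j, d ∣ p j) → IsUnit d

end NormalForm

end Mahler

end

/-! A nonzero hypergeometric series has a single component `e(λ) p`: if two occurred, their ratio
`w` would satisfy `λ w(x^b) = μ w`, which forces valuation zero and `λ = μ`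
(`IsRamRatHypergeometric.exists_eq_expo`). When `e(λ) p` solves the equation, comparing lowest
exponents produces a `λ`-admissible edge whose slope is minus the valuation of `p`. Applying this to
the part of `p` with exponents of one fixed denominator shows that all denominators divide `q_λ`
(`den_dvd_ramBound`). So `λ` and the ramification are settled, and `𝓗` becomes a space `V` of
Laurent series `f` in the variable `x^{1/q_λ}`, all of whose members are rational multiples of one
`f₀` (`insert_zero_class_eq_image`).

The valuations of members of `V` are minus slopes times `q_λ`, hence finitely many, so `V` is
finite-dimensional. A common denominator turns `V` into polynomials times a fixed series. Pulling
out their gcd and normalizing by a monomial gives a series `φ` with constant term `1` such that `V =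
P φ`, for a space `P` of Laurent polynomials without common factor (`exists_isPrimitiveFactor`).
Coprimality makes `φ` unique: the ratio of two choices must be a unit of the Laurent polynomials,
hence a monomial, hence `1`.

Since `f₀` is hypergeometric and `φ / f₀` is rational, `g = φ(x^b) / φ` is rational with `g(0) = 1`.
Iterating `φ = φ(x^b) / g` is what makes `φ` the infinite product; formally, both satisfy the same
functional equation, and a Laurent series invariant under `x ↦ x^b` is constant
(`exists_eq_infProdLaurent`). Thus `φ` and `g` determine each other, and the `p_j` are the unique
reduced echelon basis of `P`. -/

noncomputable section

namespace Mahler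

/-! ### Newton polygon: lowest exponents and denominators of exponents of solutions -/

section Coefficients

variable {K : Type*} [Field K] (b : ℕ+) {r : ℕ} (ℓ : Fin (r + 1) → K[X])
variable {F : Type*} [Field F] [Algebra K F]

/-- The coefficient of `x ^ a` in `∑ k, ℓ k * μ ^ k * M ^ k c`, for the formal series with
coefficients `c`. -/
def opCoeff (mu : F) (c : ℚ → F) (a : ℚ) : F :=
  ∑ k : Fin (r + 1), ∑ m ∈ (ℓ k).support,
    algebraMap K F ((ℓ k).coeff m) * (mu ^ (k : ℕ) * c ((a - m) / ((b : ℕ) : ℚ) ^ (k : ℕ)))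

variable {b ℓ}

/-- The term `x^m M^k` sends `x^v` to `x^(m + v b^k)`. The points minimizing `m + v b^k` lie on a
supporting line of slope `-v`, and the coefficient of the image at the minimum is `c v` times a
power of `mu` times the characteristic polynomial at `mu`. It vanishes, so at least two points
attain the minimum and they span an edge. -/
theorem exists_admissible_edge_of_least (hb : 2 ≤ (b : ℕ)) (hℓ : ∃ k, ℓ k ≠ 0) {mu : F}
    (hmu : mu ≠ 0) {c : ℚ → F} {v : ℚ} (hv : c v ≠ 0) (hlt : ∀ a < v, c a = 0)
    (hop : ∀ a, opCoeff b ℓ mu c a = 0) :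
    ∃ i j, IsAdmissibleEdge b ℓ mu i j ∧ edgeSlope b ℓ i j = -v := by
  classical
  have hb1 : (1 : ℚ) < ((b : ℕ) : ℚ) := by exact_mod_cast (by omega : 1 < (b : ℕ))
  have hbpos : ∀ k : ℕ, (0 : ℚ) < ((b : ℕ) : ℚ) ^ k := fun k => by positivity
  -- `h k` is the lowest exponent that the term with `ℓ k` can produce; `T` below collects the `k`
  -- where it is minimal.
  set h : Fin (r + 1) → ℚ := fun k =>
    ((ℓ k).natTrailingDegree : ℚ) + v * ((b : ℕ) : ℚ) ^ (k : ℕ) with hh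
  set S : Finset (Fin (r + 1)) := Finset.univ.filter fun k => ℓ k ≠ 0 with hS
  have hSne : S.Nonempty := by
    obtain ⟨k, hk⟩ := hℓ
    exact ⟨k, by simp [hS, hk]⟩
  obtain ⟨k₀, hk₀S, hk₀⟩ := S.exists_min_image h hSne
  set T : Finset (Fin (r + 1)) := S.filter fun k => h k = h k₀ with hT
  have hTne : T.Nonempty := ⟨k₀, by simp [hT, hk₀S]⟩
  have hTmem : ∀ k, k ∈ T ↔ ℓ k ≠ 0 ∧ h k = h k₀ := by intro k; simp [hT, hS]
  have hsum : ∑ k ∈ T, algebraMap K F (ℓ k).trailingCoeff * mu ^ (k : ℕ) = 0 := by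
    have h0 := hop (h k₀)
    have key : opCoeff b ℓ mu c (h k₀) =
        ∑ k ∈ T, algebraMap K F (ℓ k).trailingCoeff * mu ^ (k : ℕ) * c v := by
      rw [opCoeff, ← Finset.sum_subset (Finset.subset_univ T)]
      · refine Finset.sum_congr rfl fun k hk => ?_
        obtain ⟨hk0, hkh⟩ := (hTmem k).1 hk
        rw [Finset.sum_eq_single (ℓ k).natTrailingDegree]
        · have : (h k₀ - ((ℓ k).natTrailingDegree : ℚ)) / ((b : ℕ) : ℚ) ^ (k : ℕ) = v := by
            rw [← hkh, hh, div_eq_iff (hbpos k).ne']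
            ring
          rw [this, trailingCoeff]
          ring
        · intro m hm hne
          have hm' : (ℓ k).natTrailingDegree < m :=
            lt_of_le_of_ne (natTrailingDegree_le_of_mem_supp m hm) (Ne.symm hne)
          rw [hlt, mul_zero, mul_zero]
          rw [div_lt_iff₀ (hbpos k), ← hkh, hh]
          have : ((ℓ k).natTrailingDegree : ℚ) < m := by exact_mod_cast hm'
          simp only
          linarith
        · intro hnot
          exact absurd (natTrailingDegree_mem_support_of_nonzero hk0) hnot
      · intro k _ hkT
        refine Finset.sum_eq_zero fun m hm => ?_
        have hk0 : ℓ k ≠ 0 := by rintro hz; simp [hz] at hm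
        have hle := hk₀ k (by simp [hS, hk0])
        have hlt' : h k₀ < h k := lt_of_le_of_ne hle fun he => hkT ((hTmem k).2 ⟨hk0, he.symm⟩)
        have hm' : ((ℓ k).natTrailingDegree : ℚ) ≤ m := by
          exact_mod_cast natTrailingDegree_le_of_mem_supp m hm
        rw [hlt, mul_zero, mul_zero]
        rw [div_lt_iff₀ (hbpos k)]
        have : h k = ((ℓ k).natTrailingDegree : ℚ) + v * ((b : ℕ) : ℚ) ^ (k : ℕ) := rfl
        linarith
    rw [key, ← Finset.sum_mul] at h0
    exact (mul_eq_zero.1 h0).resolve_right hv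
  set i := T.min' hTne with hi
  set j := T.max' hTne with hj
  have hiT : i ∈ T := T.min'_mem hTne
  have hjT : j ∈ T := T.max'_mem hTne
  have hij : i < j := by
    rcases lt_or_eq_of_le (T.min'_le j hjT) with h1 | h1
    · exact h1
    · exfalso
      -- A single minimizing point would leave one nonzero term in `hsum`.
      have hTi : T = {i} := by
        refine Finset.eq_singleton_iff_unique_mem.2 ⟨hiT, fun x hx => ?_⟩
        exact le_antisymm ((T.le_max' x hx).trans h1.ge) (T.min'_le x hx)
      rw [hTi, Finset.sum_singleton] at hsum
      rcases mul_eq_zero.1 hsum with h2 | h2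
      · rw [map_eq_zero, trailingCoeff_eq_zero] at h2
        exact ((hTmem i).1 hiT).1 h2
      · exact pow_ne_zero _ hmu h2
  have hslope : edgeSlope b ℓ i j = -v := by
    have h1 := ((hTmem i).1 hiT).2
    have h2 := ((hTmem j).1 hjT).2
    have h3 : ((b : ℕ) : ℚ) ^ (i : ℕ) < ((b : ℕ) : ℚ) ^ (j : ℕ) :=
      pow_lt_pow_right₀ hb1 hij
    rw [edgeSlope, div_eq_iff (sub_pos.2 h3).ne']
    simp only [hh] at h1 h2
    linarith
  have hheight : ∀ k, edgeHeight b ℓ i j k = h k₀ - v * ((b : ℕ) : ℚ) ^ (k : ℕ) := by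
    intro k
    have h1 := ((hTmem i).1 hiT).2
    rw [edgeHeight, hslope, ← h1]
    simp only [hh]
    ring
  have hon : ∀ k, ((ℓ k).natTrailingDegree : ℚ) = edgeHeight b ℓ i j k ↔ h k = h k₀ := by
    intro k
    rw [hheight]
    simp only [hh]
    constructor <;> intro h1 <;> linarith
  refine ⟨i, j, ⟨⟨hij, ((hTmem i).1 hiT).1, ((hTmem j).1 hjT).1, fun k hk => ⟨?_, fun h1 => ?_⟩⟩,
    ?_⟩, hslope⟩
  · rw [hheight]
    have := hk₀ k (by simp [hS, hk])
    simp only [hh] at this ⊢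
    linarith
  · have hkT := (hTmem k).2 ⟨hk, (hon k).1 h1⟩
    exact ⟨T.min'_le k hkT, T.le_max' k hkT⟩
  -- The characteristic polynomial is normalized to exponents `k - i`, whence the extra factor `mu ^
  -- i`.
  · have hpow : mu ^ (i : ℕ) * aeval mu (edgeCharPoly b ℓ i j) = 0 := by
      rw [← hsum, edgeCharPoly, map_sum, Finset.mul_sum]
      rw [← Finset.sum_subset (s₁ := T) (s₂ := Finset.Icc i j)]
      · refine Finset.sum_congr rfl fun k hk => ?_
        rw [if_pos ((hon k).2 ((hTmem k).1 hk).2), aeval_monomial, mul_left_comm, ← pow_add]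
        congr 2
        have : (i : ℕ) ≤ k := T.min'_le k hk
        omega
      · intro k hk
        exact Finset.mem_Icc.2 ⟨T.min'_le k hk, T.le_max' k hk⟩
      · intro k _ hkT
        by_cases hk0 : ℓ k = 0
        · simp [hk0]
        · rw [if_neg, map_zero, mul_zero]
          intro h1
          exact hkT ((hTmem k).2 ⟨hk0, (hon k).1 h1⟩)
    exact (mul_eq_zero.1 hpow).resolve_left (pow_ne_zero _ hmu)

theorem den_natCast_mul (n : ℕ) (x : ℚ) : ((n : ℚ) * x).den = x.den / Nat.gcd n x.den := by
  rw [Rat.mul_den]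
  simp only [Rat.den_natCast, one_mul, Rat.num_natCast, Int.natAbs_mul, Int.natAbs_natCast]
  rw [Nat.Coprime.gcd_mul_right_cancel _ x.reduced]

/-- With `y = (a - m) / b^k` one has `a = b^k y + m`; adding an integer preserves denominators, and
multiplying by `b^k` divides out the gcd. -/
theorem den_of_div_pow (b : ℕ+) (a : ℚ) (m k : ℕ) :
    a.den = ((a - m) / ((b : ℕ) : ℚ) ^ k).den /
      Nat.gcd ((b : ℕ) ^ k) ((a - m) / ((b : ℕ) : ℚ) ^ k).den := by
  rw [← den_natCast_mul, ← Rat.sub_natCast_den a m]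
  congr 1
  have : ((b : ℕ) : ℚ) ^ k ≠ 0 := by positivity
  push_cast
  field_simp

theorem den_of_div_pow_of_coprime {b : ℕ+} {a : ℚ} {m k : ℕ}
    (h : Nat.Coprime b ((a - m) / ((b : ℕ) : ℚ) ^ k).den) :
    ((a - m) / ((b : ℕ) : ℚ) ^ k).den = a.den := by
  rw [den_of_div_pow b a m k, Nat.Coprime.pow_left k h, Nat.div_one]

theorem den_lt_of_not_coprime {b : ℕ+} {a : ℚ} {m k : ℕ} (hk : k ≠ 0)
    (h : ¬ Nat.Coprime b a.den) :
    a.den < ((a - m) / ((b : ℕ) : ℚ) ^ k).den ∧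
      ¬ Nat.Coprime b ((a - m) / ((b : ℕ) : ℚ) ^ k).den := by
  have hn : ¬ Nat.Coprime b ((a - m) / ((b : ℕ) : ℚ) ^ k).den := fun h' =>
    h (den_of_div_pow_of_coprime h' ▸ h')
  refine ⟨?_, hn⟩
  rw [den_of_div_pow b a m k]
  refine Nat.div_lt_self (Rat.den_pos _) ?_
  have h1 : Nat.gcd ((b : ℕ) ^ k) ((a - m) / ((b : ℕ) : ℚ) ^ k).den ≠ 1 := fun h' =>
    hn ((Nat.coprime_pow_left_iff (Nat.pos_of_ne_zero hk) _ _).1 h')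
  have h2 := Nat.gcd_pos_of_pos_right ((b : ℕ) ^ k)
    (Rat.den_pos ((a - m) / ((b : ℕ) : ℚ) ^ k))
  omega

/-- Among the exponents whose denominator shares a factor with `b`, take those of largest
denominator and, among these, the least one `v`. The lowest term of `ℓ 0` moves `c v` to a place
that nothing else reaches: terms with `k ≥ 1` would need an exponent of still larger denominator, by
`den_lt_of_not_coprime`. -/
theorem coprime_den_of_opCoeff_eq_zero (hℓ₀ : ℓ 0 ≠ 0) {mu : F}
    {c : ℚ → F} (hwf : (Function.support c).IsWF)
    {N : ℕ} (hN : ∀ a, c a ≠ 0 → a.den ≤ N) (hop : ∀ a, opCoeff b ℓ mu c a = 0) {a : ℚ}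
    (ha : c a ≠ 0) : Nat.Coprime b a.den := by
  by_contra hna
  obtain ⟨D, ⟨a₁, ha₁, hna₁, rfl⟩, hmax⟩ :
      ∃ D, (∃ x, c x ≠ 0 ∧ ¬ Nat.Coprime b x.den ∧ x.den = D) ∧
        ∀ y, c y ≠ 0 → ¬ Nat.Coprime b y.den → y.den ≤ D := by
    classical
    let P : ℕ → Prop := fun D => ∃ x, c x ≠ 0 ∧ ¬ Nat.Coprime b x.den ∧ x.den = D
    have hP : P a.den := ⟨a, ha, hna, rfl⟩
    refine ⟨Nat.findGreatest P N, Nat.findGreatest_spec (P := P) (hN a ha) hP, ?_⟩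
    exact fun y hy hny => Nat.le_findGreatest (hN y hy) ⟨y, hy, hny, rfl⟩
  have hwf' : (Function.support c ∩ {x | x.den = a₁.den}).IsWF := hwf.mono Set.inter_subset_left
  have hne : (Function.support c ∩ {x | x.den = a₁.den}).Nonempty := ⟨a₁, ha₁, rfl⟩
  set v := hwf'.min hne with hv
  obtain ⟨hvc, hvd⟩ : c v ≠ 0 ∧ v.den = a₁.den := hwf'.min_mem hne
  have hlt : ∀ y < v, y.den = a₁.den → c y = 0 := by
    intro y hy hyd
    by_contra hyc
    exact hwf'.not_lt_min hne ⟨hyc, hyd⟩ hy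
  have h0 := hop ((ℓ 0).natTrailingDegree + v)
  rw [opCoeff, Finset.sum_eq_single (0 : Fin (r + 1)),
    Finset.sum_eq_single (ℓ 0).natTrailingDegree] at h0
  · simp only [Fin.val_zero, pow_zero, div_one, one_mul, add_sub_cancel_left, mul_eq_zero,
      map_eq_zero, hvc, or_false] at h0
    exact hℓ₀ (trailingCoeff_eq_zero.1 h0)
  · intro m hm hne'
    have hm' : ((ℓ 0).natTrailingDegree : ℚ) < m := by
      exact_mod_cast lt_of_le_of_ne (natTrailingDegree_le_of_mem_supp m hm) (Ne.symm hne')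
    rw [hlt, mul_zero, mul_zero]
    · simp only [Fin.val_zero, pow_zero, div_one]
      linarith
    · simp only [Fin.val_zero, pow_zero, div_one]
      rw [Rat.sub_natCast_den, Rat.natCast_add_den, hvd]
  · intro hnot
    exact absurd (natTrailingDegree_mem_support_of_nonzero hℓ₀) hnot
  · intro k _ hk
    refine Finset.sum_eq_zero fun m _ => ?_
    have hk' : (k : ℕ) ≠ 0 := fun h => hk (Fin.ext h)
    have hd : ((ℓ 0).natTrailingDegree + v : ℚ).den = a₁.den := by
      rw [Rat.natCast_add_den, hvd]
    obtain ⟨h1, h2⟩ := den_lt_of_not_coprime (b := b)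
      (a := (ℓ 0).natTrailingDegree + v) (m := m) hk' (hd ▸ hna₁)
    by_cases hc : c (((ℓ 0).natTrailingDegree + v - m) / ((b : ℕ) : ℚ) ^ (k : ℕ)) = 0
    · rw [hc, mul_zero, mul_zero]
    · exact absurd (hmax _ hc h2) (by rw [hd] at h1; omega)
  · simp

/-- All occurring denominators are coprime to `b`, so `a ↦ b^k a + m` preserves them and the
operator acts separately on the parts of each denominator. The part with the denominator of `a` is
therefore a solution on its own, and its least exponent is minus the slope of an admissible edge. -/
theorem den_dvd_ramBound (hb : 2 ≤ (b : ℕ)) (hℓ₀ : ℓ 0 ≠ 0) {mu : F}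
    (hmu : mu ≠ 0) {c : ℚ → F} (hwf : (Function.support c).IsWF)
    {N : ℕ} (hN : ∀ a, c a ≠ 0 → a.den ≤ N) (hop : ∀ a, opCoeff b ℓ mu c a = 0) {a : ℚ}
    (ha : c a ≠ 0) : a.den ∣ ramBound b ℓ mu := by
  classical
  have hcop : ∀ y, c y ≠ 0 → Nat.Coprime b y.den := fun y hy =>
    coprime_den_of_opCoeff_eq_zero hℓ₀ hwf hN hop hy
  set c' : ℚ → F := fun y => if y.den = a.den then c y else 0 with hc'
  have hop' : ∀ y, opCoeff b ℓ mu c' y = 0 := by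
    intro y
    by_cases hy : y.den = a.den
    · rw [← hop y, opCoeff, opCoeff]
      refine Finset.sum_congr rfl fun k _ => Finset.sum_congr rfl fun m _ => ?_
      congr 2
      simp only [hc']
      split_ifs with h
      · rfl
      · by_contra hne
        exact h ((den_of_div_pow_of_coprime (hcop _ (Ne.symm hne))).trans hy)
    · rw [opCoeff]
      refine Finset.sum_eq_zero fun k _ => Finset.sum_eq_zero fun m _ => ?_
      simp only [hc']
      rw [if_neg, mul_zero, mul_zero]
      intro h
      exact hy ((den_of_div_pow_of_coprime (h ▸ hcop a ha)).symm.trans h)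
  have hwf' : (Function.support c').IsWF := hwf.mono fun y hy => by
    simp only [hc', Function.mem_support, ne_eq, ite_eq_right_iff, not_forall] at hy
    exact hy.2
  have hne : (Function.support c').Nonempty := ⟨a, by simpa [hc'] using ha⟩
  set v := hwf'.min hne with hv
  have hvc : c' v ≠ 0 := hwf'.min_mem hne
  obtain ⟨i, j, hadm, hs⟩ := exists_admissible_edge_of_least hb ⟨0, hℓ₀⟩ hmu hvc
    (fun y hy => by
      by_contra hyc
      exact hwf'.not_lt_min hne hyc hy) hop'
  have hvd : v.den = a.den := by
    by_contra h
    simp [hc', h] at hvc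
  have hden : (edgeSlope b ℓ i j).den = a.den := by rw [hs, Rat.neg_den, hvd]
  rw [← hden]
  exact Finset.dvd_lcm (f := fun e : Fin (r + 1) × Fin (r + 1) => (edgeSlope b ℓ e.1 e.2).den)
    (b := (i, j)) (by simpa [hden] using ⟨hadm, hcop a ha⟩)

end Coefficients

/-! ### Coefficients of Puiseux series -/

section PuiseuxCoefficients

variable {F : Type*} [Field F]

theorem coe_ramify (q : ℕ+) (f : LaurentSeries F) :
    ((ramify q f : Puiseux F) : HahnSeries ℚ F) = hahnRamify F q f := rfl

theorem coe_mahlerPuiseux (b : ℕ+) (p : Puiseux F) :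
    ((mahlerPuiseux b p : Puiseux F) : HahnSeries ℚ F) = hahnExpand F b p := rfl

theorem coe_mahlerPuiseux_iterate (b : ℕ+) (k : ℕ) (p : Puiseux F) :
    (((mahlerPuiseux b)^[k] p : Puiseux F) : HahnSeries ℚ F) = (hahnExpand F b)^[k] p := by
  induction k generalizing p with
  | zero => rfl
  | succ k ih => rw [Function.iterate_succ_apply, Function.iterate_succ_apply, ih, coe_mahlerPuiseux]

theorem coeff_hahnExpand (b : ℕ+) (f : HahnSeries ℚ F) (a : ℚ) :
    (hahnExpand F b f).coeff a = f.coeff (a / ((b : ℕ) : ℚ)) := by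
  have hb : ((b : ℕ) : ℚ) ≠ 0 := by exact_mod_cast b.ne_zero
  have h : a = ((b : ℕ) : ℚ) * (a / ((b : ℕ) : ℚ)) := by field_simp
  conv_lhs => rw [h]
  exact HahnSeries.embDomain_mk_coeff (f := fun k : ℚ => ((b : ℕ) : ℚ) * k) _ _

theorem coeff_hahnExpand_iterate (b : ℕ+) (k : ℕ) (f : HahnSeries ℚ F) (a : ℚ) :
    ((hahnExpand F b)^[k] f).coeff a = f.coeff (a / ((b : ℕ) : ℚ) ^ k) := by
  induction k generalizing f with
  | zero => simp
  | succ k ih =>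
    rw [Function.iterate_succ_apply, ih, coeff_hahnExpand, div_div, pow_succ]

theorem coeff_hahnRamify (q : ℕ+) (f : LaurentSeries F) (n : ℤ) :
    (hahnRamify F q f).coeff ((n : ℚ) / (q : ℕ)) = f.coeff n :=
  HahnSeries.embDomain_mk_coeff (f := fun n : ℤ => (n : ℚ) / (q : ℕ)) _ _

theorem exists_eq_div_of_coeff_hahnRamify_ne_zero {q : ℕ+} {f : LaurentSeries F} {a : ℚ}
    (h : (hahnRamify F q f).coeff a ≠ 0) : ∃ n : ℤ, a = (n : ℚ) / (q : ℕ) := by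
  by_contra hn
  refine h (HahnSeries.embDomain_of_notMem_range ?_)
  rintro ⟨n, rfl⟩
  exact hn ⟨n, rfl⟩

theorem hahnRamify_single (q : ℕ+) (n : ℤ) (c : F) :
    hahnRamify F q (HahnSeries.single n c) = HahnSeries.single ((n : ℚ) / (q : ℕ)) c :=
  HahnSeries.embDomain_single

theorem hahnRamify_C (q : ℕ+) (c : F) :
    hahnRamify F q (HahnSeries.C c) = HahnSeries.C c :=
  HahnSeries.embDomainRingHom_C

theorem coe_algebraMap_puiseux (c : F) :
    ((algebraMap F (Puiseux F) c : Puiseux F) : HahnSeries ℚ F) = HahnSeries.C c :=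
  hahnRamify_C 1 c

theorem coe_smul_puiseux (c : F) (p : Puiseux F) :
    ((c • p : Puiseux F) : HahnSeries ℚ F) = c • (p : HahnSeries ℚ F) := by
  rw [Algebra.smul_def, Subfield.coe_mul, coe_algebraMap_puiseux, HahnSeries.C_mul_eq_smul]

theorem ramify_smul (q : ℕ+) (c : F) (f : LaurentSeries F) :
    ramify q (c • f) = c • ramify q f := by
  apply Subtype.ext
  rw [coe_smul_puiseux, coe_ramify, coe_ramify, ← HahnSeries.C_mul_eq_smul, map_mul, hahnRamify_C,
    HahnSeries.C_mul_eq_smul]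

theorem ramify_injective (q : ℕ+) : Function.Injective (ramify q : LaurentSeries F → Puiseux F) :=
  fun f f' h => HahnSeries.ext (funext fun n => by
    rw [← coeff_hahnRamify q f, ← coeff_hahnRamify q f', ← coe_ramify, h, coe_ramify])

theorem ofPowerSeries_polynomial_eq_sum {Γ : Type*} [Semiring Γ] [PartialOrder Γ]
    [IsStrictOrderedRing Γ] (A : F[X]) :
    HahnSeries.ofPowerSeries Γ F (A : PowerSeries F) =
      ∑ m ∈ A.support, HahnSeries.single (m : Γ) (A.coeff m) := by
  conv_lhs => rw [A.as_sum_support, ← Polynomial.coeToPowerSeries.ringHom_apply, map_sum, map_sum]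
  refine Finset.sum_congr rfl fun m _ => ?_
  rw [Polynomial.coeToPowerSeries.ringHom_apply, ← Polynomial.C_mul_X_pow_eq_monomial,
    Polynomial.coe_mul, Polynomial.coe_C, Polynomial.coe_pow, Polynomial.coe_X, map_mul,
    HahnSeries.ofPowerSeries_C, HahnSeries.ofPowerSeries_X_pow, HahnSeries.C_apply,
    HahnSeries.single_mul_single, zero_add, mul_one]

theorem coe_polyRamify (q : ℕ+) (A : F[X]) :
    ((polyRamify q A : Puiseux F) : HahnSeries ℚ F) =
      ∑ m ∈ A.support, HahnSeries.single ((m : ℚ) / (q : ℕ)) (A.coeff m) := by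
  rw [polyRamify, coe_ramify, ofPowerSeries_polynomial_eq_sum, map_sum]
  refine Finset.sum_congr rfl fun m _ => ?_
  rw [hahnRamify_single]
  simp

theorem hahnSeries_isWF_support (f : HahnSeries ℚ F) : (Function.support f.coeff).IsWF :=
  f.isPWO_support.isWF

theorem puiseux_den_le (p : Puiseux F) :
    ∃ N : ℕ, ∀ a, (p : HahnSeries ℚ F).coeff a ≠ 0 → a.den ≤ N := by
  obtain ⟨_, q, f, rfl⟩ := p
  refine ⟨q, fun a ha => ?_⟩
  obtain ⟨n, rfl⟩ := exists_eq_div_of_coeff_hahnRamify_ne_zero ha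
  refine Nat.le_of_dvd q.pos ?_
  have h := Rat.den_dvd n (q : ℕ)
  rw [Rat.divInt_eq_div] at h
  exact_mod_cast h

/-- The exponents all lie in `(1/q) ℤ`, so the coefficients at `n / q` define the Laurent series; a
descending sequence in its support would give one in the support of `p`. -/
theorem exists_ramify_eq (q : ℕ+) (p : Puiseux F)
    (h : ∀ a, (p : HahnSeries ℚ F).coeff a ≠ 0 → a.den ∣ q) :
    ∃ f : LaurentSeries F, ramify q f = p := by
  have hq : (0 : ℚ) < (q : ℕ) := by exact_mod_cast q.pos
  have hmono : StrictMono fun n : ℤ => (n : ℚ) / (q : ℕ) := fun m n hmn => by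
    simp only
    rw [div_lt_div_iff_of_pos_right hq]
    exact_mod_cast hmn
  let f : LaurentSeries F :=
    { coeff := fun n => (p : HahnSeries ℚ F).coeff ((n : ℚ) / (q : ℕ))
      isPWO_support' := by
        rw [Set.isPWO_iff_isWF]
        have hwf := hahnSeries_isWF_support (p : HahnSeries ℚ F)
        rw [Set.isWF_iff_no_descending_seq] at hwf ⊢
        intro g hg hmem
        exact hwf (fun n => (g n : ℚ) / (q : ℕ)) (fun m n hmn => hmono (hg hmn)) hmem }
  refine ⟨f, Subtype.ext (HahnSeries.ext (funext fun a => ?_))⟩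
  rw [coe_ramify]
  by_cases ha : a.den ∣ q
  · obtain ⟨d, hd⟩ := ha
    have hd0 : (d : ℚ) ≠ 0 := by
      rintro h0
      rw [Nat.cast_eq_zero] at h0
      rw [h0, mul_zero] at hd
      exact q.ne_zero hd
    have : a = ((a.num * d : ℤ) : ℚ) / (q : ℕ) := by
      rw [hd]
      push_cast
      rw [mul_div_mul_right _ _ hd0, Rat.num_div_den]
    rw [this, coeff_hahnRamify]
  · rw [not_imp_comm.1 (h a) ha]
    by_contra hne
    obtain ⟨n, rfl⟩ := exists_eq_div_of_coeff_hahnRamify_ne_zero hne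
    refine ha ?_
    have h := Rat.den_dvd n (q : ℕ)
    rw [Rat.divInt_eq_div] at h
    exact_mod_cast h

end PuiseuxCoefficients

/-! ### Homogeneous components `e(λ) p` and the action of the operator -/

section GenSeriesStructure

variable {F : Type*} [Field F]

theorem coeff_expo_self (mu : Fˣ) (p : Puiseux F) : (expo mu p).coeff mu = p := by
  simp [expo]

theorem expo_injective (mu : Fˣ) : Function.Injective (expo mu : Puiseux F → GenSeries F) :=
  fun p p' h => by rw [← coeff_expo_self mu p, h, coeff_expo_self]

theorem expo_zero (mu : Fˣ) : expo mu (0 : Puiseux F) = 0 := by simp [expo]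

theorem expo_eq_zero {mu : Fˣ} {p : Puiseux F} : expo mu p = 0 ↔ p = 0 := by
  rw [← expo_zero mu, (expo_injective mu).eq_iff]

theorem expo_add (mu : Fˣ) (p p' : Puiseux F) : expo mu (p + p') = expo mu p + expo mu p' := by
  simp [expo, MonoidAlgebra.single_add]

theorem puiseux_smul_expo (u : Puiseux F) (mu : Fˣ) (p : Puiseux F) :
    u • expo mu p = expo mu (u * p) := by
  simp [expo, MonoidAlgebra.smul_single]

theorem smul_expo (c : F) (mu : Fˣ) (p : Puiseux F) :
    c • expo mu p = expo mu (c • p) := by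
  simp [expo, MonoidAlgebra.smul_single]

theorem expo_eq_expo {mu nu : Fˣ} {p p' : Puiseux F} (hp : p ≠ 0) (h : expo mu p = expo nu p') :
    mu = nu := by
  by_contra hne
  apply hp
  rw [← coeff_expo_self mu p, h]
  simp [expo, hne]

theorem coeff_mahler (b : ℕ+) (y : GenSeries F) (mu : Fˣ) :
    (mahler b y).coeff mu = (mu : F) • mahlerPuiseux b (y.coeff mu) := by
  classical
  induction y using MonoidAlgebra.induction_linear with
  | zero => simp
  | add f g hf hg => simp [hf, hg, smul_add]
  | single nu p =>
    have := mahler_expo b nu p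
    rw [expo] at this
    rw [this]
    by_cases h : nu = mu
    · subst h; simp [expo]
    · simp [expo, h]

theorem mahler_iterate_expo (b : ℕ+) (k : ℕ) (mu : Fˣ) (p : Puiseux F) :
    (mahler b)^[k] (expo mu p) = expo mu ((mu : F) ^ k • (mahlerPuiseux b)^[k] p) := by
  induction k with
  | zero => simp
  | succ k ih =>
    rw [Function.iterate_succ_apply', ih, mahler_expo, Function.iterate_succ_apply', pow_succ',
      mul_smul]
    congr 2
    have hC : mahlerPuiseux b (algebraMap F (Puiseux F) ((mu : F) ^ k)) =
        algebraMap F (Puiseux F) ((mu : F) ^ k) := by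
      apply Subtype.ext
      rw [coe_mahlerPuiseux, coe_algebraMap_puiseux]
      exact HahnSeries.embDomainRingHom_C
    rw [Algebra.smul_def, map_mul, hC, ← Algebra.smul_def]

variable {K : Type*} [Field K] [Algebra K F]

theorem coeff_sum_single_mul {Γ : Type*} [AddCommGroup Γ] [LinearOrder Γ] [IsOrderedAddMonoid Γ]
    {ι : Type*} (s : Finset ι) (e : ι → Γ) (c : ι → F) (h : HahnSeries Γ F) (a : Γ) :
    ((∑ m ∈ s, HahnSeries.single (e m) (c m)) * h).coeff a =
      ∑ m ∈ s, c m * h.coeff (a - e m) := by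
  rw [Finset.sum_mul, HahnSeries.coeff_sum]
  exact Finset.sum_congr rfl fun m _ => HahnSeries.coeff_single_mul

/-- This bridge reduces the equation for `e(λ) p` to scalar identities, which can be moved along
field extensions and restricted to subsets of exponents. -/
theorem applyOp_expo_eq_zero_iff (b : ℕ+) {r : ℕ} (ℓ : Fin (r + 1) → K[X]) (mu : Fˣ)
    (p : Puiseux F) :
    applyOp b ℓ (expo mu p) = 0 ↔
      ∀ a, opCoeff b ℓ (mu : F) (p : HahnSeries ℚ F).coeff a = 0 := by
  have h1 : applyOp b ℓ (expo mu p) = expo mu (∑ k : Fin (r + 1),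
      polyRamify 1 ((ℓ k).map (algebraMap K F)) *
        ((mu : F) ^ (k : ℕ) • (mahlerPuiseux b)^[(k : ℕ)] p)) := by
    rw [applyOp]
    have : ∀ s : Finset (Fin (r + 1)), ∀ f : Fin (r + 1) → Puiseux F,
        expo mu (∑ k ∈ s, f k) = ∑ k ∈ s, expo mu (f k) := fun s f =>
      map_sum (⟨⟨expo mu, expo_zero mu⟩, expo_add mu⟩ : Puiseux F →+ GenSeries F) f s
    rw [this]
    refine Finset.sum_congr rfl fun k _ => ?_
    rw [mahler_iterate_expo, puiseux_smul_expo]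
  rw [h1, expo_eq_zero, Subtype.ext_iff, HahnSeries.ext_iff, funext_iff]
  refine forall_congr' fun a => ?_
  rw [ZeroMemClass.coe_zero, HahnSeries.coeff_zero]
  have h2 : ((∑ k : Fin (r + 1), polyRamify 1 ((ℓ k).map (algebraMap K F)) *
        ((mu : F) ^ (k : ℕ) • (mahlerPuiseux b)^[(k : ℕ)] p) : Puiseux F) : HahnSeries ℚ F).coeff a
      = opCoeff b ℓ (mu : F) (p : HahnSeries ℚ F).coeff a := by
    rw [AddSubmonoidClass.coe_finsetSum, HahnSeries.coeff_sum, opCoeff]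
    refine Finset.sum_congr rfl fun k _ => ?_
    rw [Subfield.coe_mul, coe_polyRamify, coeff_sum_single_mul,
      Polynomial.support_map_of_injective _ (algebraMap K F).injective]
    refine Finset.sum_congr rfl fun m _ => ?_
    rw [coe_smul_puiseux, coe_mahlerPuiseux_iterate, HahnSeries.coeff_smul,
      coeff_hahnExpand_iterate, Polynomial.coeff_map]
    simp
  rw [h2]

end GenSeriesStructure

/-! ### Polynomials and the substitution `x ↦ x^n` in Laurent series -/

section LaurentBasics

variable {F : Type*} [Field F]

/-- Polynomials, viewed as Laurent series. -/
def polyToLaurent : F[X] →+* LaurentSeries F :=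
  (HahnSeries.ofPowerSeries ℤ F).comp Polynomial.coeToPowerSeries.ringHom

theorem polyToLaurent_apply (A : F[X]) :
    polyToLaurent A = HahnSeries.ofPowerSeries ℤ F (A : PowerSeries F) := rfl

theorem polyRamify_eq_ramify (q : ℕ+) (A : F[X]) : polyRamify q A = ramify q (polyToLaurent A) :=
  rfl

theorem coeff_polyToLaurent_natCast (A : F[X]) (n : ℕ) :
    (polyToLaurent A).coeff (n : ℤ) = A.coeff n := by
  rw [polyToLaurent_apply, HahnSeries.ofPowerSeries_apply_coeff, Polynomial.coeff_coe]

theorem coeff_ofPowerSeries_of_neg (f : PowerSeries F) {n : ℤ} (hn : n < 0) :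
    (HahnSeries.ofPowerSeries ℤ F f).coeff n = 0 := by
  rw [PowerSeries.coeff_coe, if_pos hn]

theorem polyToLaurent_injective : Function.Injective (polyToLaurent : F[X] → LaurentSeries F) :=
  fun A B h => Polynomial.ext fun n => by
    rw [← coeff_polyToLaurent_natCast, h, coeff_polyToLaurent_natCast]

theorem polyToLaurent_ne_zero {A : F[X]} (hA : A ≠ 0) : polyToLaurent A ≠ 0 := by
  rw [← map_zero (polyToLaurent (F := F))]
  exact polyToLaurent_injective.ne hA

theorem polyToLaurent_monomial (m : ℕ) (c : F) :
    polyToLaurent (monomial m c) = HahnSeries.single (m : ℤ) c := by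
  classical
  rw [polyToLaurent_apply, ofPowerSeries_polynomial_eq_sum]
  by_cases hc : c = 0
  · simp [hc]
  · rw [Polynomial.support_monomial m hc]
    simp

theorem coeff_laurentExpand_mul (n : ℕ+) (f : LaurentSeries F) (k : ℤ) :
    (laurentExpand F n f).coeff (((n : ℕ) : ℤ) * k) = f.coeff k :=
  HahnSeries.embDomain_mk_coeff (f := fun k : ℤ => ((n : ℕ) : ℤ) * k) _ _

theorem coeff_laurentExpand_of_not_dvd (n : ℕ+) (f : LaurentSeries F) {k : ℤ}
    (h : ¬ ((n : ℕ) : ℤ) ∣ k) : (laurentExpand F n f).coeff k = 0 := by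
  refine HahnSeries.embDomain_of_notMem_range ?_
  rintro ⟨m, rfl⟩
  exact h ⟨m, rfl⟩

theorem laurentExpand_injective (n : ℕ+) : Function.Injective (laurentExpand F n) :=
  fun f f' h => HahnSeries.ext (funext fun k => by
    rw [← coeff_laurentExpand_mul n, h, coeff_laurentExpand_mul])

theorem laurentExpand_ne_zero (n : ℕ+) {f : LaurentSeries F} (hf : f ≠ 0) :
    laurentExpand F n f ≠ 0 := by
  rw [← map_zero (laurentExpand F n)]
  exact (laurentExpand_injective n).ne hf

theorem laurentExpand_polyToLaurent (n : ℕ+) (A : F[X]) :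
    laurentExpand F n (polyToLaurent A) = polyToLaurent (expand F n A) := by
  induction A using Polynomial.induction_on' with
  | add A B hA hB => simp only [map_add, hA, hB]
  | monomial m c =>
    rw [Polynomial.expand_monomial, polyToLaurent_monomial, polyToLaurent_monomial]
    refine HahnSeries.embDomain_single.trans (congrArg (fun k : ℤ => HahnSeries.single k c) ?_)
    change ((n : ℕ) : ℤ) * (m : ℤ) = _
    push_cast
    ring

theorem mahlerPuiseux_ramify (b q : ℕ+) (f : LaurentSeries F) :
    mahlerPuiseux b (ramify q f) = ramify q (laurentExpand F b f) :=
  Subtype.ext (hahnExpand_hahnRamify b q f)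

theorem ramify_mul_expand (q n : ℕ+) (f : LaurentSeries F) :
    ramify (q * n) (laurentExpand F n f) = ramify q f :=
  Subtype.ext (hahnRamify_mul_expand q n f)

end LaurentBasics

/-! ### Rational Laurent series and descent from ramified rational functions -/

section Rational

variable {F : Type*} [Field F]

/-- The Laurent series is the expansion of a rational function. -/
def IsRational (f : LaurentSeries F) : Prop :=
  ∃ A B : F[X], B ≠ 0 ∧ f * polyToLaurent B = polyToLaurent A

theorem IsRational.mul {f f' : LaurentSeries F} (hf : IsRational f) (hf' : IsRational f') :
    IsRational (f * f') := by
  obtain ⟨A, B, hB, h⟩ := hf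
  obtain ⟨A', B', hB', h'⟩ := hf'
  refine ⟨A * A', B * B', mul_ne_zero hB hB', ?_⟩
  rw [map_mul, map_mul, ← h, ← h']
  ring

theorem IsRational.add {f f' : LaurentSeries F} (hf : IsRational f) (hf' : IsRational f') :
    IsRational (f + f') := by
  obtain ⟨A, B, hB, h⟩ := hf
  obtain ⟨A', B', hB', h'⟩ := hf'
  refine ⟨A * B' + A' * B, B * B', mul_ne_zero hB hB', ?_⟩
  rw [map_add, map_mul, map_mul, map_mul, ← h, ← h']
  ring

theorem IsRational.inv {f : LaurentSeries F} (hf : IsRational f) : IsRational f⁻¹ := by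
  obtain ⟨A, B, hB, h⟩ := hf
  by_cases hA : A = 0
  · rw [hA, map_zero, mul_eq_zero, or_iff_left (polyToLaurent_ne_zero hB)] at h
    exact ⟨0, 1, one_ne_zero, by simp [h]⟩
  · have hf0 : f ≠ 0 := by
      rintro rfl
      rw [zero_mul] at h
      exact polyToLaurent_ne_zero hA h.symm
    exact ⟨B, A, hA, by rw [← h, inv_mul_cancel_left₀ hf0]⟩

theorem IsRational.div {f f' : LaurentSeries F} (hf : IsRational f) (hf' : IsRational f') :
    IsRational (f / f') := by
  rw [div_eq_mul_inv]
  exact hf.mul hf'.inv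

theorem isRational_polyToLaurent (A : F[X]) : IsRational (polyToLaurent A) :=
  ⟨A, 1, one_ne_zero, by simp⟩

theorem IsRational.laurentExpand {f : LaurentSeries F} (hf : IsRational f) (n : ℕ+) :
    IsRational (laurentExpand F n f) := by
  obtain ⟨A, B, hB, h⟩ := hf
  refine ⟨expand F n A, expand F n B, (Polynomial.expand_ne_zero n.pos).2 hB, ?_⟩
  rw [← laurentExpand_polyToLaurent, ← laurentExpand_polyToLaurent, ← map_mul, h]

theorem isRational_single (n : ℤ) (c : F) : IsRational (HahnSeries.single n c) := by
  refine ⟨monomial (n.toNat) c, monomial ((-n).toNat) 1, by simp, ?_⟩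
  rw [polyToLaurent_monomial, polyToLaurent_monomial, HahnSeries.single_mul_single, mul_one]
  exact congrArg (fun k : ℤ => HahnSeries.single k c) (by omega)

theorem isRational_C (c : F) : IsRational (HahnSeries.C c : LaurentSeries F) :=
  isRational_single 0 c

theorem IsRational.smul {f : LaurentSeries F} (hf : IsRational f) (c : F) :
    IsRational (c • f) := by
  rw [← HahnSeries.C_mul_eq_smul]
  exact (isRational_C c).mul hf

theorem IsRational.ramify_mem {f : LaurentSeries F} (hf : IsRational f) (q : ℕ+) :
    ramify q f ∈ RamRat F := by
  obtain ⟨A, B, hB, h⟩ := hf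
  refine ⟨q, A, B, hB, ?_⟩
  have : ramify q (polyToLaurent B) ≠ 0 := by
    rw [← map_zero (ramify q)]
    exact (ramify_injective q).ne (polyToLaurent_ne_zero hB)
  rw [polyRamify_eq_ramify, polyRamify_eq_ramify, eq_div_iff this, ← map_mul, h]

theorem contract_monomial_of_dvd {n : ℕ} (hn : n ≠ 0) (m : ℕ) (c : F) :
    contract n (monomial (n * m) c) = monomial m c := by
  ext k
  rw [coeff_contract hn, coeff_monomial, coeff_monomial, mul_comm k n]
  simp [hn]

theorem contract_monomial_of_not_dvd {n : ℕ} (hn : n ≠ 0) {m : ℕ} (h : ¬ n ∣ m) (c : F) :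
    contract n (monomial m c) = 0 := by
  ext k
  rw [coeff_contract hn, coeff_monomial, if_neg, coeff_zero]
  rintro rfl
  exact h (dvd_mul_left _ _)

/-- Keeping only exponents divisible by `n` is linear over series in `x^n`, so the factor `f(x^n)`
passes through it. -/
theorem coeff_mul_polyToLaurent_contract (n : ℕ+) (f : LaurentSeries F) (B : F[X]) (k : ℤ) :
    (f * polyToLaurent (contract n B)).coeff k =
      (laurentExpand F n f * polyToLaurent B).coeff (((n : ℕ) : ℤ) * k) := by
  have hn : (n : ℕ) ≠ 0 := n.ne_zero
  induction B using Polynomial.induction_on' with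
  | add A B hA hB =>
    rw [Polynomial.contract_add hn, map_add, map_add, mul_add, mul_add, HahnSeries.coeff_add,
      HahnSeries.coeff_add, hA, hB]
  | monomial m c =>
    rw [polyToLaurent_monomial, HahnSeries.coeff_mul_single]
    by_cases h : (n : ℕ) ∣ m
    · obtain ⟨d, rfl⟩ := h
      rw [contract_monomial_of_dvd hn, polyToLaurent_monomial, HahnSeries.coeff_mul_single,
        ← coeff_laurentExpand_mul n f (k - d)]
      congr 2
      push_cast
      ring
    · rw [contract_monomial_of_not_dvd hn h, map_zero, mul_zero, HahnSeries.coeff_zero,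
        coeff_laurentExpand_of_not_dvd, zero_mul]
      intro h'
      rw [dvd_sub_right (dvd_mul_right _ _)] at h'
      exact h (by exact_mod_cast h')

/-- Contracting both sides of `f(x^n) B = A` leaves an equation for `f` itself. The contraction of
`B` could vanish, so a power of `x` is multiplied in beforehand. -/
theorem isRational_of_laurentExpand_mul {n : ℕ+} {f : LaurentSeries F} {A B : F[X]} (hB : B ≠ 0)
    (h : laurentExpand F n f * polyToLaurent B = polyToLaurent A) : IsRational f := by
  have hn : (n : ℕ) ≠ 0 := n.ne_zero
  obtain ⟨m, hm⟩ : ∃ m, B.coeff m ≠ 0 := by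
    by_contra! h0
    exact hB (Polynomial.ext h0)
  -- The shift moves the nonzero coefficient of `B` from `m` to `m * n`, where contraction retains
  -- it.
  set i := m * ((n : ℕ) - 1) with hi
  have him : m * n = m + i := by
    obtain ⟨d, hd⟩ := Nat.exists_eq_succ_of_ne_zero hn
    rw [hi, hd, Nat.succ_eq_add_one, Nat.add_sub_cancel]
    ring
  have h' : laurentExpand F n f * polyToLaurent (B * X ^ i) = polyToLaurent (A * X ^ i) := by
    rw [map_mul, map_mul, ← h, mul_assoc]
  refine ⟨contract n (A * X ^ i), contract n (B * X ^ i), ?_, ?_⟩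
  · intro h0
    apply hm
    have := congrArg (fun P => P.coeff m) h0
    simp only [coeff_contract hn, coeff_zero] at this
    rwa [him, coeff_mul_X_pow] at this
  · ext k
    rw [coeff_mul_polyToLaurent_contract, h']
    -- The case `f = 1` describes the contraction on the right-hand side.
    have := coeff_mul_polyToLaurent_contract n 1 (A * X ^ i) k
    rw [map_one, one_mul, one_mul] at this
    exact this.symm

/-- A rational function of `x^{1/n}` which happens to be a Laurent series in `x^{1/q}` is already
rational in `x^{1/q}`: pass to the common ramification `q * n` and contract. -/
theorem isRational_of_ramify_mem {q : ℕ+} {f : LaurentSeries F} (h : ramify q f ∈ RamRat F) :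
    IsRational f := by
  obtain ⟨n, A, B, hB, h⟩ := h
  have hB' : ramify n (polyToLaurent B) ≠ 0 := by
    rw [← map_zero (ramify n)]
    exact (ramify_injective n).ne (polyToLaurent_ne_zero hB)
  rw [polyRamify_eq_ramify, polyRamify_eq_ramify, eq_div_iff hB', ← ramify_mul_expand q n f,
    ← ramify_mul_expand n q, ← ramify_mul_expand n q, mul_comm n q, ← map_mul] at h
  have h2 := ramify_injective _ h
  rw [laurentExpand_polyToLaurent, laurentExpand_polyToLaurent] at h2
  exact isRational_of_laurentExpand_mul ((Polynomial.expand_ne_zero q.pos).2 hB) h2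

end Rational

/-! ### Laurent polynomials inside Laurent series -/

section LaurentPolynomials

variable {F : Type*} [Field F]

theorem coeff_laurentPolyToSeries (p : LaurentPolynomial F) (n : ℤ) :
    (laurentPolyToSeries p).coeff n = p.coeff n := by
  rw [laurentPolyToSeries, HahnSeries.coeff_sum, Finset.sum_eq_single n]
  · simp
  · intro m _ hm
    exact HahnSeries.coeff_single_of_ne hm.symm
  · intro h
    rw [Finsupp.notMem_support_iff.1 h]
    simp

theorem laurentPolyToSeries_single (n : ℤ) (c : F) :
    laurentPolyToSeries (AddMonoidAlgebra.single n c) = HahnSeries.single n c := by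
  classical
  ext k
  rw [coeff_laurentPolyToSeries, HahnSeries.coeff_single, AddMonoidAlgebra.coeff_single,
    Finsupp.single_apply]
  simp only [eq_comm]

theorem laurentPolyToSeries_add (p p' : LaurentPolynomial F) :
    laurentPolyToSeries (p + p') = laurentPolyToSeries p + laurentPolyToSeries p' := by
  ext k
  simp [coeff_laurentPolyToSeries]

theorem laurentPolyToSeries_zero : laurentPolyToSeries (0 : LaurentPolynomial F) = 0 := by
  ext k
  simp [coeff_laurentPolyToSeries]

theorem laurentPolyToSeries_mul (p p' : LaurentPolynomial F) :
    laurentPolyToSeries (p * p') = laurentPolyToSeries p * laurentPolyToSeries p' := by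
  induction p using AddMonoidAlgebra.induction_linear with
  | zero => simp [laurentPolyToSeries_zero]
  | add f g hf hg => rw [add_mul, laurentPolyToSeries_add, hf, hg, laurentPolyToSeries_add, add_mul]
  | single n c =>
    induction p' using AddMonoidAlgebra.induction_linear with
    | zero => simp [laurentPolyToSeries_zero]
    | add f g hf hg =>
      rw [mul_add, laurentPolyToSeries_add, hf, hg, laurentPolyToSeries_add, mul_add]
    | single m d =>
      rw [AddMonoidAlgebra.single_mul_single, laurentPolyToSeries_single,
        laurentPolyToSeries_single, laurentPolyToSeries_single, HahnSeries.single_mul_single]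

/-- Laurent polynomials, viewed as Laurent series. -/
def laurentPolyHom : LaurentPolynomial F →+* LaurentSeries F where
  toFun := laurentPolyToSeries
  map_zero' := laurentPolyToSeries_zero
  map_one' := laurentPolyToSeries_single 0 1
  map_add' := laurentPolyToSeries_add
  map_mul' := laurentPolyToSeries_mul

theorem laurentPolyHom_apply (p : LaurentPolynomial F) :
    laurentPolyHom p = laurentPolyToSeries p := rfl

theorem coeff_laurentPolyHom (p : LaurentPolynomial F) (n : ℤ) :
    (laurentPolyHom p).coeff n = p.coeff n :=
  coeff_laurentPolyToSeries p n

theorem laurentPolyHom_injective :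
    Function.Injective (laurentPolyHom : LaurentPolynomial F → LaurentSeries F) :=
  fun p p' h => LaurentPolynomial.ext fun n => by
    rw [← coeff_laurentPolyHom, h, coeff_laurentPolyHom]

theorem laurentPolyHom_toLaurent (A : F[X]) :
    laurentPolyHom (Polynomial.toLaurent A) = polyToLaurent A := by
  induction A using Polynomial.induction_on' with
  | add A B hA hB => simp only [map_add, hA, hB]
  | monomial m c =>
    rw [polyToLaurent_monomial, ← Polynomial.C_mul_X_pow_eq_monomial,
      Polynomial.toLaurent_C_mul_X_pow, ← LaurentPolynomial.single_eq_C_mul_T]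
    exact laurentPolyToSeries_single _ _

theorem laurentPolyHom_smul (c : F) (p : LaurentPolynomial F) :
    laurentPolyHom (c • p) = c • laurentPolyHom p := by
  ext k
  rw [coeff_laurentPolyHom, HahnSeries.coeff_smul, coeff_laurentPolyHom]
  simp

theorem isRational_laurentPolyHom (p : LaurentPolynomial F) : IsRational (laurentPolyHom p) := by
  induction p using AddMonoidAlgebra.induction_linear with
  | zero => simpa using isRational_polyToLaurent (0 : F[X])
  | add f g hf hg => rw [map_add]; exact hf.add hg
  | single n c =>
    rw [laurentPolyHom_apply, laurentPolyToSeries_single]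
    exact isRational_single n c

end LaurentPolynomials

/-! ### Reduced echelon bases of spaces of Laurent polynomials -/

section Echelon

variable {F : Type*} [Field F]

/-- `n` is the valuation of the nonzero Laurent polynomial `p`. -/
def HasValuation (p : LaurentPolynomial F) (n : ℤ) : Prop :=
  p.coeff n ≠ 0 ∧ ∀ m < n, p.coeff m = 0

theorem coeff_sum_smul {ι : Type*} (s : Finset ι) (c : ι → F) (p : ι → LaurentPolynomial F)
    (n : ℤ) : (∑ j ∈ s, c j • p j).coeff n = ∑ j ∈ s, c j * (p j).coeff n := by
  classical
  induction s using Finset.induction_on with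
  | empty => simp
  | insert a s ha ih => simp [Finset.sum_insert ha]

/-- Gaussian elimination. With only finitely many valuations `O'`, a member of `P` whose
coefficients on `O'` all vanish is zero; so members dual to these coefficient functionals span `P`.
-/
theorem exists_isReducedEchelon (P : Submodule F (LaurentPolynomial F)) (O : Finset ℤ)
    (hO : ∀ p ∈ P, p ≠ 0 → ∃ n ∈ O, HasValuation p n) :
    ∃ (s : ℕ) (p : Fin s → LaurentPolynomial F),
      Submodule.span F (Set.range p) = P ∧ IsReducedEchelon p := by
  classical
  set O' : Finset ℤ := O.filter fun n => ∃ p ∈ P, HasValuation p n with hO'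
  have hval : ∀ p ∈ P, p ≠ 0 → ∃ n ∈ O', HasValuation p n := by
    intro p hp hp0
    obtain ⟨n, hn, h⟩ := hO p hp hp0
    exact ⟨n, Finset.mem_filter.2 ⟨hn, p, hp, h⟩, h⟩
  -- Descending induction on `n`: start from a member of valuation `n` and clear its coefficients at
  -- the larger valuations with the dual members already found.
  have hdual : ∀ n : {n // n ∈ O'}, ∃ p ∈ P, ∀ m ∈ O', p.coeff m = if m = n then 1 else 0 := by
    intro n
    induction n using (wellFounded_gt (α := {n // n ∈ O'})).induction with
    | _ n ih =>
    obtain ⟨-, f, hfP, hf0, hflt⟩ := Finset.mem_filter.1 n.2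
    have ih' : ∀ n' : {n // n ∈ O'}, ∃ p ∈ P, n < n' →
        ∀ m ∈ O', p.coeff m = if m = n' then 1 else 0 := by
      intro n'
      by_cases h : n < n'
      · obtain ⟨p, hp, hp'⟩ := ih n' h
        exact ⟨p, hp, fun _ => hp'⟩
      · exact ⟨0, P.zero_mem, fun h' => absurd h' h⟩
    choose p hpP hp using ih'
    set T : Finset {n // n ∈ O'} := Finset.univ.filter fun n' => n < n' with hT
    refine ⟨(f.coeff n)⁻¹ • (f - ∑ n' ∈ T, f.coeff n' • p n'), P.smul_mem _ (P.sub_mem hfP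
      (P.sum_mem fun n' _ => P.smul_mem _ (hpP n'))), fun m hm => ?_⟩
    have hsum : ∑ n' ∈ T, f.coeff n' * (p n').coeff m = if (n : ℤ) < m then f.coeff m else 0 := by
      have h1 : ∀ n' ∈ T, f.coeff n' * (p n').coeff m =
          if n' = (⟨m, hm⟩ : {n // n ∈ O'}) then f.coeff m else 0 := by
        intro n' hn'
        rw [hp n' (Finset.mem_filter.1 hn').2 m hm]
        by_cases h : n' = ⟨m, hm⟩
        · subst h; simp
        · rw [if_neg h, if_neg, mul_zero]
          rintro rfl
          exact h rfl
      rw [Finset.sum_congr rfl h1, Finset.sum_ite_eq']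
      simp [hT, ← Subtype.coe_lt_coe]
    have hcoeff : ((f.coeff n)⁻¹ • (f - ∑ n' ∈ T, f.coeff n' • p n')).coeff m =
        (f.coeff n)⁻¹ * (f.coeff m - if (n : ℤ) < m then f.coeff m else 0) := by
      rw [← hsum, ← coeff_sum_smul]
      simp
    rw [hcoeff]
    rcases lt_trichotomy m n with h | h | h
    · rw [hflt m h]
      simp [h.ne]
    · subst h
      simp [hf0]
    · simp [h, h.ne']
  choose p hpP hp using hdual
  set v := O'.orderEmbOfFin rfl with hv
  have hvO : ∀ j, v j ∈ O' := fun j => Finset.orderEmbOfFin_mem _ _ _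
  have hsurj : ∀ n ∈ O', ∃ j, v j = n := by
    intro n hn
    have : n ∈ Set.range v := by rw [hv, Finset.range_orderEmbOfFin]; exact hn
    exact this
  have hpv : ∀ i j, (p ⟨v i, hvO i⟩).coeff (v j) = if i = j then 1 else 0 := by
    intro i j
    rw [hp _ _ (hvO j)]
    simp [eq_comm]
  refine ⟨O'.card, fun j => p ⟨v j, hvO j⟩, ?_, v, v.strictMono, ?_, hpv⟩
  · apply le_antisymm
    · rw [Submodule.span_le]
      rintro _ ⟨j, rfl⟩
      exact hpP _
    · intro x hx
      set d := x - ∑ j, x.coeff (v j) • p ⟨v j, hvO j⟩ with hd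
      have hdP : d ∈ P := P.sub_mem hx (P.sum_mem fun j _ => P.smul_mem _ (hpP _))
      have hd0 : d = 0 := by
        by_contra hne
        obtain ⟨n, hn, hn0, -⟩ := hval d hdP hne
        obtain ⟨i, rfl⟩ := hsurj n hn
        apply hn0
        have : d.coeff (v i) = x.coeff (v i) -
            (∑ j, x.coeff (v j) • p ⟨v j, hvO j⟩).coeff (v i) := by simp [hd]
        rw [this, coeff_sum_smul]
        simp [hpv]
      rw [sub_eq_zero.1 hd0]
      exact Submodule.sum_mem _ fun j _ => Submodule.smul_mem _ _ (Submodule.subset_span ⟨j, rfl⟩)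
  · intro j n hn
    have hne : p ⟨v j, hvO j⟩ ≠ 0 := by
      intro h0
      have := hpv j j
      simp [h0] at this
    obtain ⟨m, hm, hm0, hmlt⟩ := hval _ (hpP _) hne
    obtain ⟨i, rfl⟩ := hsurj m hm
    rw [hpv j i] at hm0
    have : j = i := by by_contra h; simp [h] at hm0
    subst this
    exact hmlt n hn

theorem eq_sum_of_mem_span {s : ℕ} {p : Fin s → LaurentPolynomial F} {v : Fin s → ℤ}
    (h : ∀ i j, (p i).coeff (v j) = if i = j then 1 else 0) {x : LaurentPolynomial F}
    (hx : x ∈ Submodule.span F (Set.range p)) : x = ∑ j, x.coeff (v j) • p j := by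
  obtain ⟨c, rfl⟩ := (Submodule.mem_span_range_iff_exists_fun F).1 hx
  refine Finset.sum_congr rfl fun j _ => ?_
  rw [coeff_sum_smul]
  simp [h]

theorem IsReducedEchelon.linearIndependent {s : ℕ} {p : Fin s → LaurentPolynomial F}
    (hp : IsReducedEchelon p) : LinearIndependent F p := by
  obtain ⟨v, -, -, h⟩ := hp
  rw [Fintype.linearIndependent_iff]
  intro c hc i
  have h1 := coeff_sum_smul Finset.univ c p (v i)
  rw [hc] at h1
  simpa [h] using h1.symm

/-- The pivots are intrinsic to the span, which is what makes the echelon basis unique: the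
coefficients of `x` at the pivots are its coordinates, so its valuation must be a pivot. -/
theorem range_valuation_eq {s : ℕ} {p : Fin s → LaurentPolynomial F} {v : Fin s → ℤ}
    (hlow : ∀ j, ∀ n < v j, (p j).coeff n = 0)
    (h : ∀ i j, (p i).coeff (v j) = if i = j then 1 else 0) :
    Set.range v = {n | ∃ x ∈ Submodule.span F (Set.range p), HasValuation x n} := by
  ext n
  constructor
  · rintro ⟨j, rfl⟩
    exact ⟨p j, Submodule.subset_span ⟨j, rfl⟩, by simp [h], hlow j⟩
  · rintro ⟨x, hx, hx0, hxlt⟩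
    have hsum := eq_sum_of_mem_span h hx
    rw [hsum, coeff_sum_smul] at hx0
    obtain ⟨j, -, hj⟩ := Finset.exists_ne_zero_of_sum_ne_zero hx0
    have h1 : ¬ n < v j := fun hlt => hj (by rw [hlow j n hlt, mul_zero])
    have h2 : ¬ v j < n := fun hlt => hj (by rw [hxlt _ hlt, zero_mul])
    exact ⟨j, by omega⟩

theorem IsReducedEchelon.eq_of_span_eq {s s' : ℕ} {p : Fin s → LaurentPolynomial F}
    {p' : Fin s' → LaurentPolynomial F} (hp : IsReducedEchelon p) (hp' : IsReducedEchelon p')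
    (hspan : Submodule.span F (Set.range p) = Submodule.span F (Set.range p')) :
    ∃ h : s = s', p = p' ∘ Fin.cast h := by
  obtain ⟨v, hv, hlow, h⟩ := hp
  obtain ⟨v', hv', hlow', h'⟩ := hp'
  have hrange : Set.range v = Set.range v' := by
    rw [range_valuation_eq hlow h, range_valuation_eq hlow' h', hspan]
  have hs : s = s' := by
    have h1 := Nat.card_range_of_injective hv.injective
    have h2 := Nat.card_range_of_injective hv'.injective
    rw [hrange, h2] at h1
    simpa using h1.symm
  subst hs
  refine ⟨rfl, ?_⟩
  have hvv : v = v' := (hv.range_inj hv').1 hrange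
  subst hvv
  funext i
  have hmem : p' i ∈ Submodule.span F (Set.range p) := by
    rw [hspan]
    exact Submodule.subset_span ⟨i, rfl⟩
  have := eq_sum_of_mem_span h hmem
  simp only [h', ite_smul, one_smul, zero_smul, Finset.sum_ite_eq, Finset.mem_univ, if_true] at this
  exact this.symm

end Echelon

/-! ### The infinite product and its functional equation -/

section InfiniteProduct

variable {F : Type*} [Field F]

theorem laurentExpand_ofPowerSeries (b : ℕ+) (f : PowerSeries F) :
    laurentExpand F b (HahnSeries.ofPowerSeries ℤ F f) =
      HahnSeries.ofPowerSeries ℤ F (PowerSeries.expand b b.ne_zero f) := by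
  ext k
  by_cases hk : ((b : ℕ) : ℤ) ∣ k
  · obtain ⟨m, rfl⟩ := hk
    rw [coeff_laurentExpand_mul]
    rcases lt_or_ge m 0 with hm | hm
    · rw [coeff_ofPowerSeries_of_neg _ hm, coeff_ofPowerSeries_of_neg]
      exact mul_neg_of_pos_of_neg (by exact_mod_cast b.pos) hm
    · obtain ⟨m, rfl⟩ := Int.eq_ofNat_of_zero_le hm
      rw [← Nat.cast_mul, HahnSeries.ofPowerSeries_apply_coeff,
        HahnSeries.ofPowerSeries_apply_coeff, PowerSeries.coeff_expand_mul]
  · rw [coeff_laurentExpand_of_not_dvd b _ hk]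
    rcases lt_or_ge k 0 with hm | hm
    · rw [coeff_ofPowerSeries_of_neg _ hm]
    · obtain ⟨m, rfl⟩ := Int.eq_ofNat_of_zero_le hm
      rw [HahnSeries.ofPowerSeries_apply_coeff, PowerSeries.coeff_expand_of_not_dvd]
      intro h
      exact hk (by exact_mod_cast h)

theorem num_denom_eval_zero {g : RatFunc F} (hg : RatFunc.eval (RingHom.id F) 0 g = 1) :
    g.num.coeff 0 = g.denom.coeff 0 ∧ g.num.coeff 0 ≠ 0 := by
  simp only [RatFunc.eval, Polynomial.eval₂_id, ← Polynomial.coeff_zero_eq_eval_zero] at hg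
  have hd : g.denom.coeff 0 ≠ 0 := by
    intro h
    simp [h] at hg
  rw [div_eq_one_iff_eq hd] at hg
  exact ⟨hg, hg ▸ hd⟩

theorem ofPowerSeries_invFactor (b : ℕ+) {g : RatFunc F}
    (hg : RatFunc.eval (RingHom.id F) 0 g = 1) (k : ℕ) :
    HahnSeries.ofPowerSeries ℤ F (invFactor b g k) =
      polyToLaurent (expand F ((b : ℕ) ^ k) g.denom) /
        polyToLaurent (expand F ((b : ℕ) ^ k) g.num) := by
  have hpos : 0 < (b : ℕ) ^ k := pow_pos b.pos k
  have hN : PowerSeries.constantCoeff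
      ((expand F ((b : ℕ) ^ k) g.num : F[X]) : PowerSeries F) ≠ 0 := by
    rw [← PowerSeries.coeff_zero_eq_constantCoeff_apply, Polynomial.coeff_coe,
      Polynomial.coeff_expand hpos]
    simpa using (num_denom_eval_zero hg).2
  have hN' : polyToLaurent (expand F ((b : ℕ) ^ k) g.num) ≠ 0 := by
    apply polyToLaurent_ne_zero
    intro h0
    simp [h0] at hN
  rw [eq_div_iff hN', invFactor, polyToLaurent_apply, polyToLaurent_apply, ← map_mul, mul_assoc,
    PowerSeries.inv_mul_cancel _ hN, mul_one]

theorem laurentExpand_ofPowerSeries_invFactor (b : ℕ+) {g : RatFunc F}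
    (hg : RatFunc.eval (RingHom.id F) 0 g = 1) (k : ℕ) :
    laurentExpand F b (HahnSeries.ofPowerSeries ℤ F (invFactor b g k)) =
      HahnSeries.ofPowerSeries ℤ F (invFactor b g (k + 1)) := by
  rw [ofPowerSeries_invFactor b hg, ofPowerSeries_invFactor b hg, map_div₀,
    laurentExpand_polyToLaurent, laurentExpand_polyToLaurent, ← Polynomial.expand_mul,
    ← Polynomial.expand_mul, pow_succ']

/-- Substituting `x^b` shifts every factor by one, so the products telescope up to the factor with
`k = 0`, which is `g.denom / g.num`. -/
theorem expand_prod_invFactor (b : ℕ+) {g : RatFunc F}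
    (hg : RatFunc.eval (RingHom.id F) 0 g = 1) (m : ℕ) :
    (g.num : PowerSeries F) * ∏ k ∈ Finset.range (m + 1), invFactor b g k =
      (g.denom : PowerSeries F) *
        PowerSeries.expand b b.ne_zero (∏ k ∈ Finset.range m, invFactor b g k) := by
  apply HahnSeries.ofPowerSeries_injective (Γ := ℤ)
  have hnum : polyToLaurent g.num ≠ 0 := by
    apply polyToLaurent_ne_zero
    intro h0
    have := (num_denom_eval_zero hg).2
    simp [h0] at this
  have h0 := ofPowerSeries_invFactor b hg 0
  rw [pow_zero, Polynomial.expand_one, Polynomial.expand_one] at h0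
  rw [map_mul, map_mul, ← laurentExpand_ofPowerSeries, map_prod, map_prod, map_prod,
    Finset.prod_range_succ', h0, ← polyToLaurent_apply, ← polyToLaurent_apply]
  simp only [laurentExpand_ofPowerSeries_invFactor b hg]
  field_simp

theorem coeff_mul_congr {f f' h : PowerSeries F} {n : ℕ}
    (H : ∀ i ≤ n, PowerSeries.coeff i f = PowerSeries.coeff i f') :
    PowerSeries.coeff n (h * f) = PowerSeries.coeff n (h * f') := by
  rw [PowerSeries.coeff_mul, PowerSeries.coeff_mul]
  refine Finset.sum_congr rfl fun x hx => ?_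
  rw [H x.2 (by have := Finset.HasAntidiagonal.mem_antidiagonal.mp hx; omega)]

theorem num_mul_infProd (b : ℕ+) (hb : 2 ≤ (b : ℕ)) {g : RatFunc F}
    (hg : RatFunc.eval (RingHom.id F) 0 g = 1) :
    (g.num : PowerSeries F) * infProd b g =
      (g.denom : PowerSeries F) * PowerSeries.expand b b.ne_zero (infProd b g) := by
  ext n
  -- With `n + 2` factors on the left, telescoping leaves `n + 1` on the right, still enough for all
  -- coefficients up to `n`.
  rw [coeff_mul_congr (f' := ∏ k ∈ Finset.range (n + 2), invFactor b g k) fun i hi =>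
      (coeff_prod_invFactor b hb g hg i (n + 2) (by omega)).symm,
    expand_prod_invFactor b hg]
  refine coeff_mul_congr fun i hi => ?_
  rw [PowerSeries.coeff_expand, PowerSeries.coeff_expand]
  split_ifs
  · refine coeff_prod_invFactor b hb g hg _ (n + 1) ?_
    have := Nat.div_le_self i b
    omega
  · rfl

theorem constantCoeff_infProd (b : ℕ+) {g : RatFunc F}
    (hg : RatFunc.eval (RingHom.id F) 0 g = 1) :
    PowerSeries.constantCoeff (infProd b g) = 1 := by
  obtain ⟨h1, h2⟩ := num_denom_eval_zero hg
  rw [← PowerSeries.coeff_zero_eq_constantCoeff_apply, infProd, PowerSeries.coeff_mk]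
  simp [invFactor, ← h1, h2]

/-- The infinite product `∏_{k ≥ 0} 1 / g(x^(b^k))` as a Laurent series. -/
def infProdLaurent (b : ℕ+) (g : RatFunc F) : LaurentSeries F :=
  HahnSeries.ofPowerSeries ℤ F (infProd b g)

/-- Laurent series which are power series with constant coefficient `1`. -/
def IsMonicUnit (φ : LaurentSeries F) : Prop :=
  φ.coeff 0 = 1 ∧ ∀ n < 0, φ.coeff n = 0

theorem IsMonicUnit.ne_zero {φ : LaurentSeries F} (h : IsMonicUnit φ) : φ ≠ 0 := by
  rintro rfl
  simpa using h.1

theorem IsMonicUnit.exists_powerSeries {φ : LaurentSeries F} (h : IsMonicUnit φ) :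
    ∃ f : PowerSeries F, φ = HahnSeries.ofPowerSeries ℤ F f ∧ PowerSeries.constantCoeff f = 1 := by
  refine ⟨PowerSeries.mk fun n => φ.coeff (n : ℤ), ?_, by simpa using h.1⟩
  ext k
  rcases lt_or_ge k 0 with hk | hk
  · rw [coeff_ofPowerSeries_of_neg _ hk, h.2 k hk]
  · obtain ⟨m, rfl⟩ := Int.eq_ofNat_of_zero_le hk
    rw [HahnSeries.ofPowerSeries_apply_coeff, PowerSeries.coeff_mk]

theorem isMonicUnit_ofPowerSeries {f : PowerSeries F} (hf : PowerSeries.constantCoeff f = 1) :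
    IsMonicUnit (HahnSeries.ofPowerSeries ℤ F f) := by
  refine ⟨?_, fun n hn => coeff_ofPowerSeries_of_neg _ hn⟩
  have := HahnSeries.ofPowerSeries_apply_coeff (Γ := ℤ) f 0
  simpa [hf] using this

theorem IsMonicUnit.mul {φ ψ : LaurentSeries F} (h : IsMonicUnit φ) (h' : IsMonicUnit ψ) :
    IsMonicUnit (φ * ψ) := by
  obtain ⟨f, rfl, hf⟩ := h.exists_powerSeries
  obtain ⟨f', rfl, hf'⟩ := h'.exists_powerSeries
  rw [← map_mul]
  exact isMonicUnit_ofPowerSeries (by rw [map_mul, hf, hf', mul_one])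

theorem IsMonicUnit.inv {φ : LaurentSeries F} (h : IsMonicUnit φ) : IsMonicUnit φ⁻¹ := by
  obtain ⟨f, hφ, hf⟩ := h.exists_powerSeries
  have h1 : φ⁻¹ = HahnSeries.ofPowerSeries ℤ F f⁻¹ := by
    apply inv_eq_of_mul_eq_one_right
    rw [hφ, ← map_mul, PowerSeries.mul_inv_cancel f (by simp [hf]), map_one]
  rw [h1]
  exact isMonicUnit_ofPowerSeries (by rw [PowerSeries.constantCoeff_inv, hf, inv_one])

theorem isMonicUnit_infProdLaurent (b : ℕ+) {g : RatFunc F}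
    (hg : RatFunc.eval (RingHom.id F) 0 g = 1) : IsMonicUnit (infProdLaurent b g) :=
  isMonicUnit_ofPowerSeries (constantCoeff_infProd b hg)

theorem num_mul_infProdLaurent (b : ℕ+) (hb : 2 ≤ (b : ℕ)) {g : RatFunc F}
    (hg : RatFunc.eval (RingHom.id F) 0 g = 1) :
    polyToLaurent g.num * infProdLaurent b g =
      polyToLaurent g.denom * laurentExpand F b (infProdLaurent b g) := by
  rw [infProdLaurent, laurentExpand_ofPowerSeries, polyToLaurent_apply, polyToLaurent_apply,
    ← map_mul, ← map_mul, num_mul_infProd b hb hg]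

/-- Invariance makes the coefficient at `b m` equal to that at `m` and kills those at non-multiples
of `b`; descent on the absolute value leaves only exponent `0`. -/
theorem eq_C_of_laurentExpand_eq (b : ℕ+) (hb : 2 ≤ (b : ℕ)) {χ : LaurentSeries F}
    (h : laurentExpand F b χ = χ) : χ = HahnSeries.C (χ.coeff 0) := by
  have key : ∀ N : ℕ, ∀ k : ℤ, k.natAbs = N → k ≠ 0 → χ.coeff k = 0 := by
    intro N
    induction N using Nat.strong_induction_on with
    | _ N ih =>
    intro k hkN hk
    rw [← h]
    by_cases hd : ((b : ℕ) : ℤ) ∣ k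
    · obtain ⟨m, rfl⟩ := hd
      have hm : m ≠ 0 := right_ne_zero_of_mul hk
      rw [coeff_laurentExpand_mul]
      refine ih m.natAbs ?_ m rfl hm
      rw [← hkN, Int.natAbs_mul, Int.natAbs_natCast]
      have := Int.natAbs_pos.2 hm
      nlinarith
    · exact coeff_laurentExpand_of_not_dvd b _ hd
  ext k
  rw [HahnSeries.C_apply]
  by_cases hk : k = 0
  · subst hk; simp
  · rw [key _ k rfl hk, HahnSeries.coeff_single_of_ne hk]

/-- Take `g = φ(x^b) / φ`. The product attached to `g` satisfies the same functional equation as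
`φ`, so their quotient is invariant under `x ↦ x^b`, hence constant, and the constant is `1`. -/
theorem exists_eq_infProdLaurent (b : ℕ+) (hb : 2 ≤ (b : ℕ)) {φ : LaurentSeries F}
    (hφ : IsMonicUnit φ) (hr : IsRational (laurentExpand F b φ / φ)) :
    ∃ g : RatFunc F, RatFunc.eval (RingHom.id F) 0 g = 1 ∧ φ = infProdLaurent b g := by
  have hφ0 := hφ.ne_zero
  obtain ⟨A, B, hB, hAB⟩ := hr
  have hBL := polyToLaurent_ne_zero hB
  set g : RatFunc F := algebraMap F[X] (RatFunc F) A / algebraMap F[X] (RatFunc F) B with hg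
  have hAg : A * g.denom = g.num * B := by
    have h1 := g.num_div_denom
    conv_rhs at h1 => rw [hg]
    rw [div_eq_div_iff (RatFunc.algebraMap_ne_zero g.denom_ne_zero)
      (RatFunc.algebraMap_ne_zero hB), ← map_mul, ← map_mul] at h1
    exact ((RatFunc.algebraMap_injective F) h1).symm
  have hfun : polyToLaurent g.num * φ = polyToLaurent g.denom * laurentExpand F b φ := by
    have h2 := congrArg polyToLaurent hAg
    rw [map_mul, map_mul, ← hAB] at h2
    field_simp at h2
    linear_combination -h2
  have heval : RatFunc.eval (RingHom.id F) 0 g = 1 := by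
    obtain ⟨f, hf, hf1⟩ := hφ.exists_powerSeries
    have h3 := hfun
    rw [hf, laurentExpand_ofPowerSeries, polyToLaurent_apply, polyToLaurent_apply, ← map_mul,
      ← map_mul] at h3
    have h4 := congrArg PowerSeries.constantCoeff (HahnSeries.ofPowerSeries_injective h3)
    rw [map_mul, map_mul, PowerSeries.constantCoeff_expand, hf1, mul_one, mul_one,
      Polynomial.constantCoeff_coe, Polynomial.constantCoeff_coe] at h4
    simp only [RatFunc.eval, Polynomial.eval₂_id, ← Polynomial.coeff_zero_eq_eval_zero]
    rw [h4, div_self]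
    -- Equality of the two constant terms does not suffice: both could be zero, where division
    -- yields `0`. Coprimality of numerator and denominator excludes this.
    intro h5
    rw [h5] at h4
    obtain ⟨u, w, huw⟩ := g.isCoprime_num_denom
    have h6 := congrArg (fun P => P.coeff 0) huw
    simp [Polynomial.mul_coeff_zero, h4, h5] at h6
  refine ⟨g, heval, ?_⟩
  have hψ := isMonicUnit_infProdLaurent b heval
  have hfun' := num_mul_infProdLaurent b hb heval
  have hnum : polyToLaurent g.num ≠ 0 := by
    apply polyToLaurent_ne_zero
    intro h0
    have := (num_denom_eval_zero heval).2
    simp [h0] at this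
  have hden := polyToLaurent_ne_zero g.denom_ne_zero
  have hχ : laurentExpand F b (φ / infProdLaurent b g) = φ / infProdLaurent b g := by
    have h1 := laurentExpand_ne_zero b hψ.ne_zero
    have h2 := hψ.ne_zero
    rw [map_div₀, div_eq_div_iff h1 h2]
    apply mul_left_cancel₀ (mul_ne_zero hnum hden)
    linear_combination (polyToLaurent g.denom * laurentExpand F b φ) * hfun' -
      (polyToLaurent g.denom * laurentExpand F b (infProdLaurent b g)) * hfun
  have hC := eq_C_of_laurentExpand_eq b hb hχ
  rw [div_eq_mul_inv, (hφ.mul hψ.inv).1, map_one, ← div_eq_mul_inv, div_eq_one_iff_eq hψ.ne_zero]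
    at hC
  exact hC

theorem eq_of_infProdLaurent_eq (b : ℕ+) (hb : 2 ≤ (b : ℕ)) {g g' : RatFunc F}
    (hg : RatFunc.eval (RingHom.id F) 0 g = 1) (hg' : RatFunc.eval (RingHom.id F) 0 g' = 1)
    (h : infProdLaurent b g = infProdLaurent b g') : g = g' := by
  have h1 := num_mul_infProdLaurent b hb hg
  have h2 := num_mul_infProdLaurent b hb hg'
  rw [← h] at h2
  have h0 := (isMonicUnit_infProdLaurent b hg).ne_zero
  have h3 : polyToLaurent (g.num * g'.denom) = polyToLaurent (g'.num * g.denom) := by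
    rw [map_mul, map_mul]
    apply mul_right_cancel₀ h0
    linear_combination polyToLaurent g'.denom * h1 - polyToLaurent g.denom * h2
  have h4 := polyToLaurent_injective h3
  rw [← g.num_div_denom, ← g'.num_div_denom, div_eq_div_iff
    (RatFunc.algebraMap_ne_zero g.denom_ne_zero) (RatFunc.algebraMap_ne_zero g'.denom_ne_zero),
    ← map_mul, ← map_mul, h4]

end InfiniteProduct

/-! ### Extracting the common transcendental factor of a space of Laurent series -/

section Factor

variable {F : Type*} [Field F]

theorem smul_mul_laurent (c : F) (f g : LaurentSeries F) : c • f * g = c • (f * g) := by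
  rw [← HahnSeries.C_mul_eq_smul, ← HahnSeries.C_mul_eq_smul, mul_assoc]

/-- Multiplication of Laurent polynomials by a fixed Laurent series. -/
def mulSeries (φ : LaurentSeries F) : LaurentPolynomial F →ₗ[F] LaurentSeries F where
  toFun p := laurentPolyHom p * φ
  map_add' p p' := by rw [map_add, add_mul]
  map_smul' c p := by rw [laurentPolyHom_smul, RingHom.id_apply, smul_mul_laurent]

theorem mulSeries_apply (φ : LaurentSeries F) (p : LaurentPolynomial F) :
    mulSeries φ p = laurentPolyHom p * φ := rfl

theorem mulSeries_injective {φ : LaurentSeries F} (hφ : φ ≠ 0) :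
    Function.Injective (mulSeries φ) := fun _ _ h =>
  laurentPolyHom_injective (mul_right_cancel₀ hφ h)

/-- The Laurent polynomials `p` with `p φ ∈ V` have no common divisors except for units. -/
def IsPrimitiveFactor (V : Submodule F (LaurentSeries F)) (φ : LaurentSeries F) : Prop :=
  ∀ d : LaurentPolynomial F, (∀ p, mulSeries φ p ∈ V → d ∣ p) → IsUnit d

theorem exists_coprime_num_denom (A : F[X]) {B : F[X]} (hB : B ≠ 0) :
    ∃ A' B' : F[X], IsCoprime A' B' ∧ B' ≠ 0 ∧ A * B' = A' * B := by
  set g : RatFunc F := algebraMap F[X] (RatFunc F) A / algebraMap F[X] (RatFunc F) B with hg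
  refine ⟨g.num, g.denom, g.isCoprime_num_denom, g.denom_ne_zero, ?_⟩
  have h1 := g.num_div_denom
  conv_rhs at h1 => rw [hg]
  rw [div_eq_div_iff (RatFunc.algebraMap_ne_zero g.denom_ne_zero)
    (RatFunc.algebraMap_ne_zero hB), ← map_mul, ← map_mul] at h1
  exact ((RatFunc.algebraMap_injective F) h1).symm

theorem exists_common_denominator (V : Submodule F (LaurentSeries F)) [FiniteDimensional F V]
    {f₀ : LaurentSeries F} (hf₀ : f₀ ≠ 0) (hr : ∀ v ∈ V, IsRational (v / f₀)) :
    ∃ Q : F[X], Q ≠ 0 ∧ ∀ v ∈ V, ∃ A : F[X], v * polyToLaurent Q = polyToLaurent A * f₀ := by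
  classical
  obtain ⟨S, hS⟩ := (Module.Finite.iff_fg (N := V)).1 inferInstance
  have hSV : ∀ v ∈ S, v ∈ V := fun v hv => hS ▸ Submodule.subset_span hv
  obtain ⟨Q, hQ, h⟩ : ∃ Q : F[X], Q ≠ 0 ∧ ∀ v ∈ S, ∃ A : F[X],
      v * polyToLaurent Q = polyToLaurent A * f₀ := by
    clear hS
    induction S using Finset.induction_on with
    | empty => exact ⟨1, one_ne_zero, by simp⟩
    | insert a S ha ih =>
      obtain ⟨Q, hQ, h⟩ := ih fun v hv => hSV v (Finset.mem_insert_of_mem hv)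
      obtain ⟨A, B, hB, hAB⟩ := hr a (hSV a (Finset.mem_insert_self _ _))
      refine ⟨Q * B, mul_ne_zero hQ hB, fun v hv => ?_⟩
      rcases Finset.mem_insert.1 hv with rfl | hv
      · refine ⟨A * Q, ?_⟩
        rw [map_mul, map_mul, ← hAB]
        field_simp
      · obtain ⟨A', hA'⟩ := h v hv
        refine ⟨A' * B, ?_⟩
        rw [map_mul, map_mul]
        linear_combination polyToLaurent B * hA'
  refine ⟨Q, hQ, fun v hv => ?_⟩
  rw [← hS] at hv
  induction hv using Submodule.span_induction with
  | mem x hx => exact h x hx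
  | zero => exact ⟨0, by simp⟩
  | add x y _ _ hx hy =>
    obtain ⟨A, hA⟩ := hx
    obtain ⟨A', hA'⟩ := hy
    exact ⟨A + A', by rw [map_add, add_mul, add_mul, hA, hA']⟩
  | smul c x _ hx =>
    obtain ⟨A, hA⟩ := hx
    refine ⟨Polynomial.C c * A, ?_⟩
    rw [smul_mul_laurent, hA, map_mul, ← Polynomial.monomial_zero_left, polyToLaurent_monomial,
      Nat.cast_zero, mul_assoc, HahnSeries.single_zero_mul_eq_smul]

theorem isMonicUnit_mul_single {f : LaurentSeries F} (hf : f ≠ 0) :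
    IsMonicUnit (f * HahnSeries.single (-f.order) (f.coeff f.order)⁻¹) := by
  have hc : f.coeff f.order ≠ 0 := fun h => hf (HahnSeries.coeff_order_eq_zero.1 h)
  refine ⟨?_, fun n hn => ?_⟩
  · rw [HahnSeries.coeff_mul_single, zero_sub, neg_neg, mul_inv_cancel₀ hc]
  · rw [HahnSeries.coeff_mul_single, HahnSeries.coeff_eq_zero_of_lt_order (by omega), zero_mul]

/-- After multiplication by `Q / f₀` the space consists of polynomials; `G` is their gcd. The series
`G f₀ / Q` divides all of `V`, and a monomial, a unit among Laurent polynomials, normalizes it to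
constant term `1`. -/
theorem exists_isPrimitiveFactor (V : Submodule F (LaurentSeries F)) [FiniteDimensional F V]
    (hV : V ≠ ⊥) {f₀ : LaurentSeries F} (hf₀ : f₀ ≠ 0) (hr : ∀ v ∈ V, IsRational (v / f₀)) :
    ∃ φ, IsMonicUnit φ ∧ IsRational (φ / f₀) ∧ V ≤ LinearMap.range (mulSeries φ) ∧
      IsPrimitiveFactor V φ := by
  obtain ⟨Q, hQ, hQV⟩ := exists_common_denominator V hf₀ hr
  have hQL := polyToLaurent_ne_zero hQ
  set I : Ideal F[X] :=
    Ideal.span {A | ∃ v ∈ V, v * polyToLaurent Q = polyToLaurent A * f₀} with hI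
  obtain ⟨G, hG⟩ : ∃ G, I = Ideal.span {G} := ⟨_, (Ideal.span_singleton_generator I).symm⟩
  have hdvd : ∀ v ∈ V, ∃ A', v * polyToLaurent Q = polyToLaurent (G * A') * f₀ := by
    intro v hv
    obtain ⟨A, hA⟩ := hQV v hv
    have hAI : A ∈ I := Ideal.subset_span ⟨v, hv, hA⟩
    rw [hG, Ideal.mem_span_singleton] at hAI
    obtain ⟨A', rfl⟩ := hAI
    exact ⟨A', hA⟩
  have hG0 : G ≠ 0 := by
    rintro rfl
    obtain ⟨v, hv, hv0⟩ := (Submodule.ne_bot_iff V).1 hV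
    obtain ⟨A', hA'⟩ := hdvd v hv
    rw [zero_mul, map_zero, zero_mul] at hA'
    exact mul_ne_zero hv0 hQL hA'
  have hGL := polyToLaurent_ne_zero hG0
  set φ₀ : LaurentSeries F := polyToLaurent G / polyToLaurent Q * f₀ with hφ₀
  have hφ₀0 : φ₀ ≠ 0 := mul_ne_zero (div_ne_zero hGL hQL) hf₀
  set k := φ₀.order with hk
  set c := φ₀.coeff k with hc
  have hc0 : c ≠ 0 := fun h => hφ₀0 (HahnSeries.coeff_order_eq_zero.1 h)
  set φ : LaurentSeries F := φ₀ * HahnSeries.single (-k) c⁻¹ with hφ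
  have hT : (HahnSeries.single k c : LaurentSeries F) * HahnSeries.single (-k) c⁻¹ = 1 := by
    rw [HahnSeries.single_mul_single, mul_inv_cancel₀ hc0, add_neg_cancel]
    rfl
  have hT' : (AddMonoidAlgebra.single k c : LaurentPolynomial F) *
      AddMonoidAlgebra.single (-k) c⁻¹ = 1 := by
    rw [AddMonoidAlgebra.single_mul_single, mul_inv_cancel₀ hc0, add_neg_cancel]
    rfl
  have hmul : ∀ v A', v * polyToLaurent Q = polyToLaurent (G * A') * f₀ →
      mulSeries φ (Polynomial.toLaurent A' * AddMonoidAlgebra.single k c) = v := by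
    intro v A' h
    rw [mulSeries_apply, map_mul, laurentPolyHom_toLaurent, laurentPolyHom_apply,
      laurentPolyToSeries_single, hφ, hφ₀]
    apply mul_right_cancel₀ hQL
    rw [h, map_mul]
    linear_combination (polyToLaurent A' * polyToLaurent G * f₀) * hT +
      (polyToLaurent A' * HahnSeries.single k c * f₀ * HahnSeries.single (-k) c⁻¹) *
        div_mul_cancel₀ (polyToLaurent G) hQL
  refine ⟨φ, isMonicUnit_mul_single hφ₀0, ?_, ?_, ?_⟩
  · have : φ / f₀ = polyToLaurent G / polyToLaurent Q * HahnSeries.single (-k) c⁻¹ := by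
      rw [hφ, hφ₀]
      field_simp
    rw [this]
    exact ((isRational_polyToLaurent G).div (isRational_polyToLaurent Q)).mul (isRational_single _ _)
  · intro v hv
    obtain ⟨A', hA'⟩ := hdvd v hv
    exact ⟨_, hmul v A' hA'⟩
  · intro d hd
    -- `J` holds the polynomials divisible by `d` as Laurent polynomials. All cofactors of `G` lie
    -- in `J`, so `I ≤ G J`; as `G ∈ I`, this puts `1` in `J`.
    set J : Ideal F[X] := Ideal.comap (Polynomial.toLaurent : F[X] →+* LaurentPolynomial F)
      (Ideal.span {d}) with hJ
    have hIJ : I ≤ Ideal.span {G} * J := by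
      rw [hI, Ideal.span_le]
      rintro A ⟨v, hv, hA⟩
      obtain ⟨A', hA'⟩ := hdvd v hv
      have hAA : A = G * A' := by
        rw [hA'] at hA
        exact polyToLaurent_injective (mul_right_cancel₀ hf₀ hA).symm
      refine Ideal.mem_span_singleton_mul.2 ⟨A', ?_, hAA.symm⟩
      rw [hJ, Ideal.mem_comap, Ideal.mem_span_singleton]
      have h1 := hd _ (by rw [hmul v A' hA']; exact hv)
      have h2 := h1.mul_right (AddMonoidAlgebra.single (-k) c⁻¹)
      rwa [mul_assoc, hT', mul_one] at h2
    have hGI : G ∈ I := by rw [hG]; exact Ideal.mem_span_singleton_self G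
    obtain ⟨z, hz, hzG⟩ := Ideal.mem_span_singleton_mul.1 (hIJ hGI)
    have hz1 : z = 1 := mul_left_cancel₀ hG0 (by rw [hzG, mul_one])
    rw [hz1, hJ, Ideal.mem_comap, map_one, Ideal.mem_span_singleton] at hz
    exact isUnit_of_dvd_one hz

/-- Clearing the negative powers in the inverse shows that `A` divides a power of the prime `X`. -/
theorem exists_eq_C_mul_X_pow_of_isUnit_toLaurent {A : F[X]}
    (hA : IsUnit (Polynomial.toLaurent A)) : ∃ (a : F) (i : ℕ), A = monomial i a := by
  obtain ⟨u, hu⟩ := hA.exists_right_inv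
  obtain ⟨n, f, hf⟩ := u.exists_T_pow
  have h1 : A * f = X ^ n := by
    apply Polynomial.toLaurent_injective
    rw [map_mul, hf, ← mul_assoc, hu, one_mul, Polynomial.toLaurent_X_pow]
  obtain ⟨i, -, hi⟩ := (dvd_prime_pow Polynomial.prime_X n).1 (Dvd.intro f h1)
  obtain ⟨w, hw⟩ := hi.symm
  obtain ⟨a, -, ha⟩ := Polynomial.isUnit_iff.1 w.isUnit
  exact ⟨a, i, by rw [← hw, ← ha, mul_comm, Polynomial.C_mul_X_pow_eq_monomial]⟩

/-- Here `φ' / φ = A / B` in lowest terms. Writing `p φ' = p₁ φ` gives `p A = p₁ B`, and coprimality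
gives the divisibility. -/
theorem toLaurent_dvd_of_mul_eq {V : Submodule F (LaurentSeries F)} {φ φ' : LaurentSeries F}
    (hφ : φ ≠ 0) (hV : V ≤ LinearMap.range (mulSeries φ)) {A B : F[X]} (hAB : IsCoprime A B)
    (h : φ' * polyToLaurent B = polyToLaurent A * φ) (p : LaurentPolynomial F)
    (hp : mulSeries φ' p ∈ V) : Polynomial.toLaurent B ∣ p := by
  obtain ⟨p₁, hp₁⟩ := hV hp
  rw [mulSeries_apply, mulSeries_apply] at hp₁
  have h1 : p * Polynomial.toLaurent A = p₁ * Polynomial.toLaurent B := by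
    apply laurentPolyHom_injective
    rw [map_mul, map_mul, laurentPolyHom_toLaurent, laurentPolyHom_toLaurent]
    apply mul_right_cancel₀ hφ
    linear_combination (-polyToLaurent B) * hp₁ - laurentPolyHom p * h
  have h2 : IsCoprime (Polynomial.toLaurent B) (Polynomial.toLaurent A) :=
    (hAB.map (Polynomial.toLaurent : F[X] →+* LaurentPolynomial F)).symm
  exact h2.dvd_of_dvd_mul_right (h1 ▸ dvd_mul_left _ _)

/-- By the preceding divisibility, used in both directions, the reduced numerator and denominator of
`φ' / φ` are common divisors, hence units, hence monomials. Constant terms `1` then leave no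
freedom. -/
theorem IsPrimitiveFactor.unique {V : Submodule F (LaurentSeries F)} (hV : V ≠ ⊥)
    {φ φ' : LaurentSeries F} (hφ : IsMonicUnit φ) (hφ' : IsMonicUnit φ')
    (hr : V ≤ LinearMap.range (mulSeries φ)) (hr' : V ≤ LinearMap.range (mulSeries φ'))
    (hp : IsPrimitiveFactor V φ) (hp' : IsPrimitiveFactor V φ') : φ = φ' := by
  have hφ0 := hφ.ne_zero
  have hφ0' := hφ'.ne_zero
  obtain ⟨v, hv, hv0⟩ := (Submodule.ne_bot_iff V).1 hV
  obtain ⟨p, hpv⟩ := hr hv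
  obtain ⟨p', hpv'⟩ := hr' hv
  rw [mulSeries_apply] at hpv hpv'
  have hp0' : laurentPolyHom p' ≠ 0 := by
    intro h0
    rw [h0, zero_mul] at hpv'
    exact hv0 hpv'.symm
  have hratio : φ' / φ = laurentPolyHom p / laurentPolyHom p' := by
    rw [div_eq_div_iff hφ0 hp0']
    linear_combination hpv' - hpv
  obtain ⟨A₀, B₀, hB₀, hAB₀⟩ : IsRational (φ' / φ) := by
    rw [hratio]
    exact (isRational_laurentPolyHom p).div (isRational_laurentPolyHom p')
  obtain ⟨A, B, hcop, hB, hAB⟩ := exists_coprime_num_denom A₀ hB₀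
  have h : φ' * polyToLaurent B = polyToLaurent A * φ := by
    have h1 := congrArg polyToLaurent hAB
    rw [map_mul, map_mul, ← hAB₀] at h1
    have h2 := polyToLaurent_ne_zero hB₀
    field_simp at h1
    linear_combination h1
  have hBu := hp' _ (toLaurent_dvd_of_mul_eq hφ0 hr hcop h)
  have hAu := hp _ (toLaurent_dvd_of_mul_eq hφ0' hr' hcop.symm
    (by linear_combination -h : φ * polyToLaurent A = polyToLaurent B * φ'))
  obtain ⟨a, i, rfl⟩ := exists_eq_C_mul_X_pow_of_isUnit_toLaurent hAu
  obtain ⟨c, j, rfl⟩ := exists_eq_C_mul_X_pow_of_isUnit_toLaurent hBu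
  have hc : c ≠ 0 := by rintro rfl; simp at hB
  have ha : a ≠ 0 := by rintro rfl; simp at hAu
  rw [polyToLaurent_monomial, polyToLaurent_monomial] at h
  have hcoeff : ∀ n : ℤ, φ'.coeff (n - j) * c = a * φ.coeff (n - i) := by
    intro n
    rw [← HahnSeries.coeff_mul_single, h, HahnSeries.coeff_single_mul]
  have hij : i = j := by
    rcases lt_trichotomy i j with hlt | heq | hlt
    · have := hcoeff i
      rw [sub_self, hφ.1, hφ'.2 _ (by omega)] at this
      simp [ha.symm] at this
    · exact heq
    · have := hcoeff j
      rw [sub_self, hφ'.1, hφ.2 _ (by omega)] at this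
      simp [hc] at this
  subst hij
  have hac : c = a := by
    have := hcoeff i
    rwa [sub_self, hφ.1, hφ'.1, one_mul, mul_one] at this
  subst hac
  rw [mul_comm φ'] at h
  have hs : (HahnSeries.single (i : ℤ) c : LaurentSeries F) ≠ 0 := by simpa using hc
  exact (mul_left_cancel₀ hs h).symm

end Factor

/-! ### Existence and uniqueness of normal forms of a space of Laurent series -/

section NormalForm

variable {F : Type*} [Field F]

/-- The conditions on `g` and `p` in a normal form of the space `V` of Laurent series. -/
def IsNormalForm (b : ℕ+) (V : Submodule F (LaurentSeries F)) (t : NormalFormData F) : Prop :=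
  0 < t.s ∧ RatFunc.eval (RingHom.id F) 0 t.g = 1 ∧
    Submodule.span F (Set.range fun j => mulSeries (infProdLaurent b t.g) (t.p j)) = V ∧
    IsReducedEchelon t.p ∧ IsCoprimeFamily t.p

/-- The coefficients at `O` determine a member of `V`, since a nonzero one has a nonzero coefficient
at its order. -/
theorem finiteDimensional_of_order_mem {V : Submodule F (LaurentSeries F)} {O : Finset ℤ}
    (hO : ∀ v ∈ V, v ≠ 0 → v.order ∈ O) : FiniteDimensional F V := by
  let f : V →ₗ[F] (O → F) :=
    { toFun := fun v n => (v : LaurentSeries F).coeff n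
      map_add' := fun v w => by ext n; simp
      map_smul' := fun c v => by ext n; simp }
  refine Module.Finite.of_injective f ?_
  rw [← LinearMap.ker_eq_bot, LinearMap.ker_eq_bot']
  intro v hv
  by_contra hne
  have hne' : (v : LaurentSeries F) ≠ 0 := fun h => hne (Subtype.ext h)
  have := congrFun hv ⟨_, hO v v.2 hne'⟩
  exact hne' (HahnSeries.coeff_order_eq_zero.1 this)

theorem IsMonicUnit.order_eq_zero {φ : LaurentSeries F} (hφ : IsMonicUnit φ) : φ.order = 0 := by
  apply le_antisymm
  · exact HahnSeries.order_le_of_coeff_ne_zero (by rw [hφ.1]; exact one_ne_zero)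
  · by_contra h
    exact hφ.ne_zero (HahnSeries.coeff_order_eq_zero.1 (hφ.2 _ (not_le.1 h)))

theorem span_range_mulSeries (φ : LaurentSeries F) {s : ℕ} (p : Fin s → LaurentPolynomial F) :
    Submodule.span F (Set.range fun j => mulSeries φ (p j)) =
      (Submodule.span F (Set.range p)).map (mulSeries φ) := by
  rw [Submodule.map_span, ← Set.range_comp]
  rfl

theorem exists_isNormalForm (b : ℕ+) (hb : 2 ≤ (b : ℕ)) (lam : Fˣ)
    (V : Submodule F (LaurentSeries F)) (hV : V ≠ ⊥)
    {f₀ : LaurentSeries F} (hf₀ : f₀ ≠ 0) (hr : ∀ v ∈ V, IsRational (v / f₀))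
    (hf₀r : IsRational (laurentExpand F b f₀ / f₀))
    {O : Finset ℤ} (hO : ∀ v ∈ V, v ≠ 0 → v.order ∈ O) :
    ∃ t : NormalFormData F, t.lam = lam ∧ IsNormalForm b V t := by
  have := finiteDimensional_of_order_mem hO
  obtain ⟨φ, hφ, hφr, hrange, hprim⟩ := exists_isPrimitiveFactor V hV hf₀ hr
  have hφ0 := hφ.ne_zero
  -- Rationality of `φ(x^b) / φ` is inherited from that of `f₀(x^b) / f₀` because `φ / f₀` is
  -- rational.
  obtain ⟨g, hg, rfl⟩ := exists_eq_infProdLaurent b hb hφ (by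
    have h1 : laurentExpand F b φ / φ =
        laurentExpand F b (φ / f₀) * (laurentExpand F b f₀ / f₀) / (φ / f₀) := by
      have h2 := laurentExpand_ne_zero b hf₀
      rw [map_div₀]
      field_simp
    rw [h1]
    exact ((hφr.laurentExpand b).mul hf₀r).div hφr)
  obtain ⟨s, p, hspan, hech⟩ := exists_isReducedEchelon
    (V.comap (mulSeries (infProdLaurent b g))) O (by
      intro p hp hp0
      have hp1 : laurentPolyHom p ≠ 0 := by
        rw [← map_zero (laurentPolyHom (F := F))]
        exact laurentPolyHom_injective.ne hp0
      have h1 := hO _ hp (mul_ne_zero hp1 hφ0)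
      rw [mulSeries_apply, HahnSeries.order_mul hp1 hφ0, hφ.order_eq_zero, add_zero] at h1
      refine ⟨_, h1, ?_, fun m hm => ?_⟩
      · rw [← coeff_laurentPolyHom]
        exact fun h => hp1 (HahnSeries.coeff_order_eq_zero.1 h)
      · rw [← coeff_laurentPolyHom]
        exact HahnSeries.coeff_eq_zero_of_lt_order hm)
  have hVspan : Submodule.span F (Set.range fun j => mulSeries (infProdLaurent b g) (p j)) = V := by
    rw [span_range_mulSeries, hspan, Submodule.map_comap_eq_self hrange]
  refine ⟨⟨lam, g, s, p⟩, rfl, ?_, hg, hVspan, hech, ?_⟩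
  · by_contra hs
    have hs0 : s = 0 := by simpa using hs
    subst hs0
    apply hV
    rw [← hVspan]
    simp
  · intro d hd
    refine hprim d fun x hx => ?_
    have hx' : x ∈ Submodule.span F (Set.range p) := by rw [hspan]; exact hx
    obtain ⟨c, rfl⟩ := (Submodule.mem_span_range_iff_exists_fun F).1 hx'
    refine Finset.dvd_sum fun j _ => ?_
    rw [LaurentPolynomial.smul_eq_C_mul]
    exact (hd j).mul_left _

theorem IsNormalForm.le_range {b : ℕ+} {V : Submodule F (LaurentSeries F)}
    {t : NormalFormData F} (h : IsNormalForm b V t) :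
    V ≤ LinearMap.range (mulSeries (infProdLaurent b t.g)) := by
  rw [← h.2.2.1, Submodule.span_le]
  rintro _ ⟨j, rfl⟩
  exact ⟨_, rfl⟩

theorem IsNormalForm.isPrimitiveFactor {b : ℕ+} {V : Submodule F (LaurentSeries F)}
    {t : NormalFormData F} (h : IsNormalForm b V t) :
    IsPrimitiveFactor V (infProdLaurent b t.g) := by
  intro d hd
  refine h.2.2.2.2 d fun j => hd _ ?_
  rw [← h.2.2.1]
  exact Submodule.subset_span ⟨j, rfl⟩

theorem IsNormalForm.unique {b : ℕ+} (hb : 2 ≤ (b : ℕ)) {V : Submodule F (LaurentSeries F)}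
    (hV : V ≠ ⊥) {t t' : NormalFormData F} (h : IsNormalForm b V t) (h' : IsNormalForm b V t')
    (hlam : t.lam = t'.lam) : t = t' := by
  have hφ := isMonicUnit_infProdLaurent b h.2.1
  have hφ' := isMonicUnit_infProdLaurent b h'.2.1
  have hg : t.g = t'.g := eq_of_infProdLaurent_eq b hb h.2.1 h'.2.1
    (IsPrimitiveFactor.unique hV hφ hφ' h.le_range h'.le_range h.isPrimitiveFactor
      h'.isPrimitiveFactor)
  have hspan : Submodule.span F (Set.range t.p) = Submodule.span F (Set.range t'.p) := by
    apply Submodule.map_injective_of_injective (mulSeries_injective hφ.ne_zero)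
    rw [← span_range_mulSeries, h.2.2.1, hg, ← span_range_mulSeries, h'.2.2.1]
  obtain ⟨hs, hp⟩ := h.2.2.2.1.eq_of_span_eq h'.2.2.2.1 hspan
  obtain ⟨lam, g, s, p⟩ := t
  obtain ⟨lam', g', s', p'⟩ := t'
  simp only at hs hp hg hlam
  subst hs hg hlam
  simp only [Fin.cast_refl, Function.comp_id] at hp
  rw [hp]

end NormalForm

/-! ### Hypergeometric solutions and similarity classes -/

section Solutions

variable {F : Type*} [Field F]

theorem coeff_eq_zero_of_lt_order (p : HahnSeries ℚ F) : ∀ a < p.order, p.coeff a = 0 :=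
  fun _ ha => HahnSeries.coeff_eq_zero_of_lt_order ha

theorem IsRamRatHypergeometric.exists_eq_expo {b : ℕ+} (hb : 2 ≤ (b : ℕ)) {y : GenSeries F}
    (hy0 : y ≠ 0) (hy : IsRamRatHypergeometric b y) :
    ∃ (lam : Fˣ) (p : Puiseux F), p ≠ 0 ∧ y = expo lam p := by
  obtain ⟨u, -, hu⟩ := hy
  have hcoeff : ∀ mu : Fˣ, (mu : F) • mahlerPuiseux b (y.coeff mu) = u * y.coeff mu := by
    intro mu
    rw [← coeff_mahler, hu]
    rfl
  obtain ⟨lam, hlam⟩ : ∃ lam, y.coeff lam ≠ 0 := by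
    by_contra! h
    exact hy0 (MonoidAlgebra.ext (Finsupp.ext h))
  refine ⟨lam, y.coeff lam, hlam, MonoidAlgebra.ext (Finsupp.ext fun mu => ?_)⟩
  by_cases hmu : mu = lam
  · subst hmu
    rw [coeff_expo_self]
  have h0 : (expo lam (y.coeff lam)).coeff mu = 0 := by simp [expo, Ne.symm hmu]
  rw [h0]
  by_contra hne
  set w : Puiseux F := y.coeff lam / y.coeff mu with hw
  have hw0 : (w : HahnSeries ℚ F) ≠ 0 := fun h => div_ne_zero hlam hne (Subtype.ext h)
  have hMw : (lam : F) • mahlerPuiseux b w = (mu : F) • w := by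
    have h1 := hcoeff lam
    have h2 := hcoeff mu
    have h3 : mahlerPuiseux b (y.coeff mu) ≠ 0 := by
      rw [← map_zero (mahlerPuiseux b)]
      exact (mahlerPuiseux b).injective.ne hne
    rw [Algebra.smul_def] at h1 h2 ⊢
    rw [Algebra.smul_def, hw, map_div₀, mul_div_assoc', mul_div_assoc', div_eq_div_iff h3 hne]
    linear_combination y.coeff mu * h1 - y.coeff lam * h2
  have hc : ∀ a, (lam : F) * (w : HahnSeries ℚ F).coeff (a / ((b : ℕ) : ℚ)) =
      mu * (w : HahnSeries ℚ F).coeff a := by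
    intro a
    have h1 := congrArg (fun p : Puiseux F => (p : HahnSeries ℚ F).coeff a) hMw
    simpa only [coe_smul_puiseux, coe_mahlerPuiseux, HahnSeries.coeff_smul, coeff_hahnExpand,
      smul_eq_mul] using h1
  set v := (w : HahnSeries ℚ F).order with hv
  have hwv : (w : HahnSeries ℚ F).coeff v ≠ 0 := fun h =>
    hw0 (HahnSeries.coeff_order_eq_zero.1 h)
  have hb1 : (1 : ℚ) < ((b : ℕ) : ℚ) := by exact_mod_cast (by omega : 1 < (b : ℕ))
  have hb0 : (0 : ℚ) < ((b : ℕ) : ℚ) := by linarith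
  -- Both inequalities come from evaluating `hc` where one side is the leading coefficient of `w`.
  -- Together they force `v = 0`, and then the leading coefficients give `lam = mu`.
  have hv1 : v ≤ v / ((b : ℕ) : ℚ) := by
    by_contra! hlt
    have h1 := hc v
    rw [coeff_eq_zero_of_lt_order _ _ hlt, mul_zero] at h1
    exact mul_ne_zero mu.ne_zero hwv h1.symm
  have hv2 : v ≤ ((b : ℕ) : ℚ) * v := by
    by_contra! hlt
    have h1 := hc (((b : ℕ) : ℚ) * v)
    rw [coeff_eq_zero_of_lt_order _ _ hlt, mul_zero, mul_div_cancel_left₀ _ hb0.ne'] at h1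
    exact mul_ne_zero lam.ne_zero hwv h1
  rw [le_div_iff₀ hb0] at hv1
  have hv0 : v = 0 := by nlinarith
  have h1 := hc v
  rw [hv0, zero_div] at h1
  rw [hv0] at hwv
  exact hmu (Units.ext (mul_right_cancel₀ hwv h1)).symm

variable {E : Type*} [Field E] [Algebra F E] {K : Type*} [Field K] [Algebra K F] [Algebra K E]
  [IsScalarTower K F E] {b : ℕ+} {r : ℕ} {ℓ : Fin (r + 1) → K[X]}

theorem opCoeff_algebraMap (mu : F) (c : ℚ → F) (a : ℚ) :
    opCoeff b ℓ (algebraMap F E mu) (fun x => algebraMap F E (c x)) a =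
      algebraMap F E (opCoeff b ℓ mu c a) := by
  simp only [opCoeff, map_sum, map_mul, map_pow, ← IsScalarTower.algebraMap_apply]

theorem opCoeff_add (mu : F) (c c' : ℚ → F) (a : ℚ) :
    opCoeff b ℓ mu (c + c') a = opCoeff b ℓ mu c a + opCoeff b ℓ mu c' a := by
  simp only [opCoeff, Pi.add_apply, mul_add, Finset.sum_add_distrib]

theorem opCoeff_smul (mu s : F) (c : ℚ → F) (a : ℚ) :
    opCoeff b ℓ mu (s • c) a = s * opCoeff b ℓ mu c a := by
  simp only [opCoeff, Pi.smul_apply, smul_eq_mul, Finset.mul_sum]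
  exact Finset.sum_congr rfl fun k _ => Finset.sum_congr rfl fun m _ => by ring

theorem coeff_ramify_map (q : ℕ+) (f : LaurentSeries F) (a : ℚ) :
    (hahnRamify E q (HahnSeries.map f (algebraMap F E))).coeff a =
      algebraMap F E ((hahnRamify F q f).coeff a) := by
  by_cases h : ∃ n : ℤ, a = (n : ℚ) / (q : ℕ)
  · obtain ⟨n, rfl⟩ := h
    rw [coeff_hahnRamify, coeff_hahnRamify, HahnSeries.map_coeff]
  · rw [not_imp_comm.1 exists_eq_div_of_coeff_hahnRamify_ne_zero h,
      not_imp_comm.1 exists_eq_div_of_coeff_hahnRamify_ne_zero h, map_zero]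

theorem coeff_order_puiseux_ne_zero {p : Puiseux F} (hp : p ≠ 0) :
    (p : HahnSeries ℚ F).coeff (p : HahnSeries ℚ F).order ≠ 0 := fun h =>
  hp (Subtype.ext (HahnSeries.coeff_order_eq_zero.1 h))

variable (E) in
theorem mem_solRootSet (hb : 2 ≤ (b : ℕ)) (hℓ₀ : ℓ 0 ≠ 0) {mu : Fˣ} {p : Puiseux F} (hp : p ≠ 0)
    (h : applyOp b ℓ (expo mu p) = 0) : algebraMap F E mu ∈ solRootSet b ℓ E := by
  have hop := (applyOp_expo_eq_zero_iff b ℓ mu p).1 h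
  have hmu : algebraMap F E mu ≠ 0 := by simp
  constructor
  · obtain ⟨i, j, hij, -⟩ := exists_admissible_edge_of_least (b := b) (ℓ := ℓ)
      (mu := algebraMap F E mu) (c := fun a => algebraMap F E ((p : HahnSeries ℚ F).coeff a))
      hb ⟨0, hℓ₀⟩ hmu (v := (p : HahnSeries ℚ F).order)
      (by simpa using fun h' => hp (Subtype.ext h'))
      (fun a ha => by rw [coeff_eq_zero_of_lt_order _ a ha, map_zero])
      (fun a => by rw [opCoeff_algebraMap, hop, map_zero])
    exact ⟨i, j, hij⟩
  · obtain ⟨_, q, f, rfl⟩ := p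
    refine ⟨Units.map (algebraMap F E).toMonoidHom mu,
      ramify q (HahnSeries.map f (algebraMap F E)), rfl, ?_, ?_⟩
    · intro h0
      apply coeff_order_puiseux_ne_zero hp
      apply (algebraMap F E).injective
      rw [map_zero]
      have h1 := coeff_ramify_map (E := E) q f (hahnRamify F q f).order
      rw [← coe_ramify, h0] at h1
      exact h1.symm
    · rw [applyOp_expo_eq_zero_iff]
      intro a
      have h1 : ((ramify q (HahnSeries.map f (algebraMap F E)) : Puiseux E) :
          HahnSeries ℚ E).coeff = fun a => algebraMap F E ((hahnRamify F q f).coeff a) :=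
        funext fun a => coeff_ramify_map q f a
      rw [h1]
      refine (opCoeff_algebraMap (mu : F) _ a).trans ?_
      rw [hop a, map_zero]

variable (E) in
theorem exists_eq_ramify_ramBound (hb : 2 ≤ (b : ℕ)) (hℓ₀ : ℓ 0 ≠ 0) {mu : Fˣ} {p : Puiseux F}
    (h : applyOp b ℓ (expo mu p) = 0) :
    ∃ f : LaurentSeries F, ramify (ramBound b ℓ (algebraMap F E mu)) f = p := by
  have hop := (applyOp_expo_eq_zero_iff b ℓ mu p).1 h
  obtain ⟨N, hN⟩ := puiseux_den_le p
  refine exists_ramify_eq _ p fun a ha => ?_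
  refine den_dvd_ramBound (mu := algebraMap F E mu)
    (c := fun a => algebraMap F E ((p : HahnSeries ℚ F).coeff a)) hb hℓ₀ (by simp) ?_ (N := N)
    (fun a ha => hN a ?_) (fun a => by rw [opCoeff_algebraMap, hop, map_zero]) (a := a) ?_
  · refine (hahnSeries_isWF_support (p : HahnSeries ℚ F)).mono fun a ha => ?_
    exact fun h0 => ha (by simp only [h0, map_zero])
  · exact fun h0 => ha (by simp only [h0, map_zero])
  · simpa using ha

/-- There are finitely many pairs `i, j`, so this leaves finitely many possible orders for fixed
`q`. -/
theorem coe_order_eq_neg_edgeSlope (hb : 2 ≤ (b : ℕ)) (hℓ₀ : ℓ 0 ≠ 0) {mu : Fˣ} {q : ℕ+}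
    {f : LaurentSeries F} (hf : f ≠ 0) (h : applyOp b ℓ (expo mu (ramify q f)) = 0) :
    ∃ i j, (f.order : ℚ) / (q : ℕ) = -edgeSlope b ℓ i j := by
  have hop := (applyOp_expo_eq_zero_iff b ℓ mu (ramify q f)).1 h
  have hq : (0 : ℚ) < (q : ℕ) := by exact_mod_cast q.pos
  obtain ⟨i, j, -, hij⟩ := exists_admissible_edge_of_least hb ⟨0, hℓ₀⟩ mu.ne_zero
    (c := (hahnRamify F q f).coeff) (v := (f.order : ℚ) / (q : ℕ))
    (by
      rw [coeff_hahnRamify]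
      exact fun h0 => hf (HahnSeries.coeff_order_eq_zero.1 h0))
    (fun a ha => by
      by_contra hne
      obtain ⟨n, rfl⟩ := exists_eq_div_of_coeff_hahnRamify_ne_zero hne
      rw [coeff_hahnRamify] at hne
      rw [div_lt_div_iff_of_pos_right hq, Int.cast_lt] at ha
      exact hne (HahnSeries.coeff_eq_zero_of_lt_order ha)) hop
  exact ⟨i, j, by rw [hij, neg_neg]⟩

/-- The linear map `f(x) ↦ e(λ) f(x^{1/q})`. -/
def expoRamify (lam : Fˣ) (q : ℕ+) : LaurentSeries F →ₗ[F] GenSeries F where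
  toFun f := expo lam (ramify q f)
  map_add' f f' := by rw [map_add, expo_add]
  map_smul' c f := by rw [ramify_smul, ← smul_expo, RingHom.id_apply]

theorem expoRamify_apply (lam : Fˣ) (q : ℕ+) (f : LaurentSeries F) :
    expoRamify lam q f = expo lam (ramify q f) := rfl

theorem expoRamify_injective (lam : Fˣ) (q : ℕ+) : Function.Injective (expoRamify lam q) :=
  (expo_injective lam).comp (ramify_injective q)

theorem mahler_expoRamify (lam : Fˣ) (q : ℕ+) (f : LaurentSeries F) :
    mahler b (expoRamify lam q f) = expoRamify lam q ((lam : F) • laurentExpand F b f) := by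
  rw [expoRamify_apply, mahler_expo, mahlerPuiseux_ramify, ← ramify_smul, expoRamify_apply]

variable (b ℓ) in
/-- The Laurent series `f` for which `e(λ) f(x^{1/q})` is a solution and `f / f₀` is rational. -/
def rationalSolutions (lam : Fˣ) (q : ℕ+) (f₀ : LaurentSeries F) :
    Submodule F (LaurentSeries F) where
  carrier := {f | applyOp b ℓ (expoRamify lam q f) = 0 ∧ IsRational (f / f₀)}
  zero_mem' := by
    refine ⟨?_, ?_⟩
    · rw [expoRamify_apply, map_zero, applyOp_expo_eq_zero_iff]
      intro a
      simp [opCoeff]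
    · rw [zero_div, ← map_zero polyToLaurent]
      exact isRational_polyToLaurent 0
  add_mem' := by
    rintro f f' ⟨h, hr⟩ ⟨h', hr'⟩
    rw [expoRamify_apply, applyOp_expo_eq_zero_iff] at h h'
    refine ⟨?_, by rw [add_div]; exact hr.add hr'⟩
    rw [expoRamify_apply, applyOp_expo_eq_zero_iff]
    intro a
    rw [map_add, Subfield.coe_add, HahnSeries.coeff_add', opCoeff_add, h, h', add_zero]
  smul_mem' := by
    rintro c f ⟨h, hr⟩
    rw [expoRamify_apply, applyOp_expo_eq_zero_iff] at h
    refine ⟨?_, ?_⟩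
    · rw [expoRamify_apply, applyOp_expo_eq_zero_iff]
      intro a
      rw [ramify_smul, coe_smul_puiseux, HahnSeries.coeff_smul', opCoeff_smul, h, mul_zero]
    · rw [div_eq_mul_inv, smul_mul_laurent, ← div_eq_mul_inv]
      exact hr.smul c

theorem isRational_laurentExpand_div {lam : Fˣ} {q : ℕ+} {f : LaurentSeries F} (hf : f ≠ 0) :
    IsRamRatHypergeometric b (expoRamify lam q f) ↔ IsRational (laurentExpand F b f / f) := by
  have hf' : ramify q f ≠ 0 := by
    rw [← map_zero (ramify q)]
    exact (ramify_injective q).ne hf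
  constructor
  · rintro ⟨u, hu, h⟩
    rw [mahler_expoRamify, expoRamify_apply, expoRamify_apply, puiseux_smul_expo] at h
    have h1 := expo_injective lam h
    rw [← div_eq_iff hf', ← map_div₀] at h1
    rw [← h1] at hu
    have h2 := (isRational_of_ramify_mem hu).smul (lam : F)⁻¹
    rwa [div_eq_mul_inv, smul_mul_laurent, smul_smul, inv_mul_cancel₀ lam.ne_zero, one_smul,
      ← div_eq_mul_inv] at h2
  · intro h
    refine ⟨_, (h.smul (lam : F)).ramify_mem q, ?_⟩
    rw [mahler_expoRamify, expoRamify_apply, expoRamify_apply, puiseux_smul_expo, ← map_mul,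
      smul_mul_laurent, div_mul_cancel₀ _ hf]

variable (E) in
-- Every member of the class has the same `λ`, hence the same ramification `q`, and similarity
-- becomes rationality of `f / f₀`, a linear condition. Hypergeometricity then comes for free from
-- that of `f₀`.
theorem insert_zero_class_eq_image (hb : 2 ≤ (b : ℕ)) (hℓ₀ : ℓ 0 ≠ 0) {lam : Fˣ} {q : ℕ+}
    (hq : q = ramBound b ℓ (algebraMap F E lam)) {f₀ : LaurentSeries F} (hf₀ : f₀ ≠ 0)
    (hhyp : IsRamRatHypergeometric b (expoRamify lam q f₀)) :
    insert 0 {y | applyOp b ℓ y = 0 ∧ IsRamRatHypergeometric b y ∧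
        RamRatSimilar y (expoRamify lam q f₀)} =
      ((rationalSolutions b ℓ lam q f₀).map (expoRamify lam q) : Set (GenSeries F)) := by
  have hf₀' : ramify q f₀ ≠ 0 := by
    rw [← map_zero (ramify q)]
    exact (ramify_injective q).ne hf₀
  ext y
  constructor
  · rintro (rfl | ⟨hy, -, u, hu, hu0, rfl⟩)
    · exact Submodule.zero_mem _
    · rw [expoRamify_apply, puiseux_smul_expo] at hy ⊢
      obtain ⟨f, hf⟩ := exists_eq_ramify_ramBound E hb hℓ₀ hy
      rw [← hq] at hf
      rw [← hf] at hy ⊢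
      refine ⟨f, ⟨hy, isRational_of_ramify_mem (q := q) ?_⟩, rfl⟩
      rwa [map_div₀, hf, mul_div_cancel_right₀ _ hf₀']
  · rintro ⟨f, ⟨hf, hr⟩, rfl⟩
    by_cases hf0 : f = 0
    · left
      rw [hf0, map_zero]
    · right
      have hf0' := laurentExpand_ne_zero b hf₀
      refine ⟨hf, ?_, ramify q (f / f₀), hr.ramify_mem q, ?_, ?_⟩
      · rw [isRational_laurentExpand_div hf0]
        rw [isRational_laurentExpand_div hf₀] at hhyp
        have h1 : laurentExpand F b f / f =
            laurentExpand F b (f / f₀) * (laurentExpand F b f₀ / f₀) / (f / f₀) := by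
          rw [map_div₀]
          field_simp
        rw [h1]
        exact ((hr.laurentExpand b).mul hhyp).div hr
      · rw [← map_zero (ramify q)]
        exact (ramify_injective q).ne (div_ne_zero hf0 hf₀)
      · rw [expoRamify_apply, expoRamify_apply, puiseux_smul_expo, ← map_mul,
          div_mul_cancel₀ _ hf₀]

theorem order_mem_of_mem_rationalSolutions (hb : 2 ≤ (b : ℕ)) (hℓ₀ : ℓ 0 ≠ 0) (lam : Fˣ)
    (q : ℕ+) (f₀ : LaurentSeries F) :
    ∃ O : Finset ℤ, ∀ f ∈ rationalSolutions b ℓ lam q f₀, f ≠ 0 → f.order ∈ O := by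
  classical
  refine ⟨Finset.univ.image fun e : Fin (r + 1) × Fin (r + 1) =>
    -- The floor only converts to `ℤ`: for an actual order the number is already an integer.
    ⌊-edgeSlope b ℓ e.1 e.2 * (q : ℕ)⌋, fun f hf hf0 => ?_⟩
  obtain ⟨i, j, hij⟩ := coe_order_eq_neg_edgeSlope hb hℓ₀ hf0 hf.1
  have hq : ((q : ℕ) : ℚ) ≠ 0 := by exact_mod_cast q.ne_zero
  refine Finset.mem_image.2 ⟨(i, j), Finset.mem_univ _, ?_⟩
  simp only
  rw [← hij, div_mul_cancel₀ _ hq, Int.floor_intCast]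

theorem NormalFormData.basisElt_eq (t : NormalFormData F) (b q : ℕ+) :
    t.basisElt b q =
      fun j => expoRamify t.lam q (mulSeries (infProdLaurent b t.g) (t.p j)) := rfl

theorem NormalFormData.span_range_basisElt (t : NormalFormData F) (b q : ℕ+) :
    Submodule.span F (Set.range (t.basisElt b q)) =
      (Submodule.span F (Set.range fun j => mulSeries (infProdLaurent b t.g) (t.p j))).map
        (expoRamify t.lam q) := by
  rw [Submodule.map_span, ← Set.range_comp]
  rfl

variable (E) in
theorem existsUnique_normalForm (hb : 2 ≤ (b : ℕ)) (hℓ₀ : ℓ 0 ≠ 0) {C : Set (GenSeries F)}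
    (hC : IsNontrivialSimilarityClass b ℓ C) :
    ∃! t : NormalFormData F,
      algebraMap F E t.lam ∈ solRootSet b ℓ E ∧
      0 < t.s ∧
      RatFunc.eval (RingHom.id F) 0 t.g = 1 ∧
      (LinearIndependent F (t.basisElt b (ramBound b ℓ (algebraMap F E t.lam))) ∧
        (Submodule.span F (Set.range (t.basisElt b (ramBound b ℓ (algebraMap F E t.lam)))) :
          Set (GenSeries F)) = insert 0 C) ∧
      IsReducedEchelon t.p ∧
      IsCoprimeFamily t.p := by
  obtain ⟨y₀, hy₀, hsol, hhyp, rfl⟩ := hC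
  obtain ⟨lam, p₀, hp₀, rfl⟩ := hhyp.exists_eq_expo hb hy₀
  obtain ⟨q, hq⟩ : ∃ q, q = ramBound b ℓ (algebraMap F E lam) := ⟨_, rfl⟩
  obtain ⟨f₀, hf₀⟩ := exists_eq_ramify_ramBound E hb hℓ₀ hsol
  rw [← hq] at hf₀
  have hf₀0 : f₀ ≠ 0 := by
    rintro rfl
    rw [map_zero] at hf₀
    exact hp₀ hf₀.symm
  subst hf₀
  rw [← expoRamify_apply] at hsol hhyp ⊢
  rw [insert_zero_class_eq_image E hb hℓ₀ hq hf₀0 hhyp]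
  set V := rationalSolutions b ℓ lam q f₀ with hVdef
  have hV : V ≠ ⊥ := by
    rw [Submodule.ne_bot_iff]
    refine ⟨f₀, ⟨hsol, ?_⟩, hf₀0⟩
    rw [div_self hf₀0, ← map_one polyToLaurent]
    exact isRational_polyToLaurent 1
  obtain ⟨O, hO⟩ := order_mem_of_mem_rationalSolutions hb hℓ₀ lam q f₀
  obtain ⟨t, rfl, ht⟩ := exists_isNormalForm b hb lam V hV hf₀0 (fun v hv => hv.2)
    ((isRational_laurentExpand_div hf₀0).1 hhyp) hO
  refine ⟨t, ⟨mem_solRootSet E hb hℓ₀ hp₀ hsol, ht.1, ht.2.1, ⟨?_, ?_⟩, ht.2.2.2.1,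
    ht.2.2.2.2⟩, ?_⟩
  · rw [← hq, NormalFormData.basisElt_eq]
    have h1 := ht.2.2.2.1.linearIndependent.map' (mulSeries (infProdLaurent b t.g))
      (LinearMap.ker_eq_bot.2 (mulSeries_injective (isMonicUnit_infProdLaurent b ht.2.1).ne_zero))
    exact h1.map' (expoRamify t.lam q) (LinearMap.ker_eq_bot.2 (expoRamify_injective t.lam q))
  · rw [← hq, NormalFormData.span_range_basisElt, ht.2.2.1]
  · rintro t' ⟨-, hs', hg', ⟨hli', hspan'⟩, hech', hcop'⟩
    -- The ramification of a competing tuple depends on its own `λ`, so `λ` has to be identified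
    -- first, from a nonzero basis element lying in the component `e(λ)`.
    have hlam : t'.lam = t.lam := by
      have hmem : t'.basisElt b (ramBound b ℓ (algebraMap F E t'.lam)) ⟨0, hs'⟩ ∈
          (V.map (expoRamify t.lam q) : Set (GenSeries F)) := by
        rw [← hspan']
        exact Submodule.subset_span ⟨_, rfl⟩
      obtain ⟨f, -, hf⟩ := hmem
      have hne := hli'.ne_zero ⟨0, hs'⟩
      refine expo_eq_expo (fun h0 => hne ?_) hf.symm
      rw [NormalFormData.basisElt, h0, expo_zero]
    refine IsNormalForm.unique hb hV ⟨hs', hg', ?_, hech', hcop'⟩ ht hlam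
    rw [NormalFormData.span_range_basisElt, hlam, ← hq, SetLike.coe_set_eq] at hspan'
    exact Submodule.map_injective_of_injective (expoRamify_injective t.lam q) hspan'

end Solutions

end Mahler

end

theorem mainTheorem9 {K Kbar : Type*} [Field K] [CharZero K] [Field Kbar] [Algebra K Kbar]
    [IsAlgClosure K Kbar] (L : IntermediateField K Kbar)
    (b : ℕ+) (hb : 2 ≤ (b : ℕ)) (r : ℕ) (ℓ : Fin (r + 1) → K[X])
    (hℓ₀ : ℓ 0 ≠ 0) (hℓr : ℓ (Fin.last r) ≠ 0)
    (C : Set (Mahler.GenSeries L)) (hC : Mahler.IsNontrivialSimilarityClass b ℓ C) :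
    ∃! t : Mahler.NormalFormData L,
      ((t.lam : L) : Kbar) ∈ Mahler.solRootSet b ℓ Kbar ∧
      0 < t.s ∧
      RatFunc.eval (RingHom.id L) 0 t.g = 1 ∧
      (LinearIndependent L
          (t.basisElt b (Mahler.ramBound b ℓ ((t.lam : L) : Kbar))) ∧
        (Submodule.span L
            (Set.range (t.basisElt b (Mahler.ramBound b ℓ ((t.lam : L) : Kbar)))) :
          Set (Mahler.GenSeries L)) = insert 0 C) ∧
      Mahler.IsReducedEchelon t.p ∧
      Mahler.IsCoprimeFamily t.p := by
  exact Mahler.existsUnique_normalForm Kbar hb hℓ₀ hC
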